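/- **Definitions.** A *tropical curve* is a connected metric graph whose vertices are $3$-valent (inner vertices) or $1$-valent (leaves); edges at leaves are called ends and have infinite length, all other edges (inner edges) have finite length; the genus is the first Betti number. Let $g\ge 0$, let $\alpha,\beta$ be partitions of the same integer, and let $\underline z\subset\mathbb R$ be a set of $r=l(\alpha)+l(\beta)+2g-2$ points, where $l$ denotes the number of parts. A *tropical cover of type* $(g,\alpha,\beta,\underline z)$ is a continuous map $\varphi:C\to\mathbb R\cup\{\pm\infty\}$ from a tropical curve $C$ of genus $g$ that maps the inner vertices onto $\underline z$ and the leaves to $\pm\infty$, is affine on every edge $e$ with a positive integer slope $\omega(e)$ (the weight of $e$, with $e$ oriented by increasing $\varphi$), is balanced at each inner vertex (the incoming and the outgoing weights have equal sums), and whose ends going to $-\infty$ (resp. $+\infty$) have the parts of $\alpha$ (resp. $\beta$) as weights. An isomorphism $\varphi_1\to\varphi_2$ is an isometry $\Phi$ of the curves, leaves removed, with $\varphi_2\circ\Phi=\varphi_1$. A *symmetric cycle* (resp. *symmetric fork*) is a pair of inner edges (resp. ends) of equal weight adjacent to the same two inner vertices (resp. the same inner vertex); $\operatorname{Sym}(\varphi)$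 is the set of all of them. The cover $\varphi$ is a *generalized zigzag cover* if there is a connected subgraph $S$ of $C$, disjoint from all symmetric cycles and forks, containing at least one inner vertex and no edge of even weight, such that every connected component of $C\setminus S$ is a *tail*: for some integer $k\geq1$ it is a chain that starts either with an end of weight $2k$, or with a symmetric fork of weight $k$ followed by an edge of weight $2k$, that continues with $n\ge0$ symmetric cycles of weight $k$, each followed by an edge of weight $2k$, where $n=0$ unless $k$ is odd, and whose last edge of weight $2k$ is attached to a vertex of $S$. A *colouring* $\rho$ of $\varphi$ consists of a subset $I_\rho\subset\operatorname{Sym}(\varphi)$ and of a choice of one of two colours for each connected component of the subgraph formed by the even-weight edges not in an element of $I_\rho$. Its multiplicity is $$\operatorname{mult}^{\mathbb R}(\varphi,\rho)=2^{|E(I_\rho)|-|\operatorname{Sym}(\varphi)|}\prod_{c}\omega(c),$$ where $E(I_\rho)$ is the set of inner edges of even weight not in an element of $I_\rho$, and $c$ runs over the symmetric cycles in $I_\rho$, $\omega(c)$ being the common weight of the two edges of $c$. Put $m(\varphi)=0$ if $\operatorname{mult}^{\mathbb R}(\varphi,\rho)$ is an odd integer for some colouring $\rho$, and $m(\varphi)=1$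 otherwise. The *generalized zigzag number* is $$Z_g(\alpha,\beta;\Lambda_{0,r})=\sum_{[\varphi]}2^{m(\varphi)},$$ where the sum is over the isomorphism classes of generalized zigzag covers of type $(g,\alpha,\beta,\underline z)$. For a partition $\lambda$, let $\lambda_o$ be the set of odd integers that appear an odd number of times in $\lambda$, and let $(\lambda,1^n)$ be $\lambda$ with $n$ parts equal to $1$ added. **Theorem 6.2.** Let $\lambda$ and $\mu$ be two partitions with $|\lambda|=|\mu|$ and $|\lambda_o|+|\mu_o|\le 2$. Then there is an integer $N_0\ge0$, depending only on $\lambda$ and $\mu$, such that for all integers $g\ge0$ and $m>N_0$, with $$r_0=l(\lambda)+l(\mu)+2g-2+4m,\qquad r_1=4m-4N_0+2g,$$ and for all choices of $r_0$, respectively $r_1$, points of $\mathbb R$ used to define the two numbers, $$Z_g((\lambda,1^{2m}),(\mu,1^{2m});\Lambda_{0,r_0})\ \ge\ Z_g((1^{2m-2N_0+1}),(1^{2m-2N_0+1});\Lambda_{0,r_1}).$$ -/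

import Mathlib

open scoped ENNReal

/-- A finite graph with ends: `V` is the set of inner vertices, `E` the set of edges. Every edge has
two endpoints `src` and `tgt`; the value `none` stands for a leaf (a `1`-valent vertex), each leaf
belonging to exactly one edge. -/
structure EndGraph where
  V : Type
  E : Type
  [finV : Fintype V]
  [finE : Fintype E]
  src : E → Option V
  tgt : E → Option V

attribute [instance] EndGraph.finV EndGraph.finE

namespace EndGraph

variable (G : EndGraph)

/-- The edge `e` is adjacent to the inner vertex `v`. -/
def Incident (e : G.E) (v : G.V) : Prop := G.src e = some v ∨ G.tgt e = some v

/-- An inner edge is an edge without leaves; the other edges are the ends. -/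
def IsInner (e : G.E) : Prop := G.src e ≠ none ∧ G.tgt e ≠ none

/-- The incidence graph on the cells of `G` (inner vertices and open edges). A union of cells
is a connected subspace of `G` exactly when it induces a connected subgraph here. -/
def cellGraph : SimpleGraph (G.V ⊕ G.E) :=
  SimpleGraph.fromRel fun a b => ∃ v e, a = Sum.inl v ∧ b = Sum.inr e ∧ G.Incident e v

/-- The valence of an inner vertex (a loop counts twice). -/
noncomputable def valence (v : G.V) : ℕ :=
  Nat.card {e : G.E // G.src e = some v} + Nat.card {e : G.E // G.tgt e = some v}

/-- The number of leaves. -/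
noncomputable def numLeaves : ℕ :=
  Nat.card {e : G.E // G.src e = none} + Nat.card {e : G.E // G.tgt e = none}

/-- The first Betti number (number of edges minus number of vertices, leaves included, plus one)
of a connected graph. -/
noncomputable def genus : ℤ :=
  (Fintype.card G.E : ℤ) - (Fintype.card G.V + G.numLeaves) + 1

end EndGraph

/-- A tropical curve: a connected metric graph with only `1`- and `3`-valent vertices. The inner
edges have finite positive length, the ends have infinite length. -/
structure TropicalCurve extends EndGraph where
  length : E → ℝ≥0∞
  connected : toEndGraph.cellGraph.Connected
  valence_eq : ∀ v, toEndGraph.valence v = 3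
  length_ne_zero : ∀ e, length e ≠ 0
  length_eq_top : ∀ e, length e = ⊤ ↔ ¬ toEndGraph.IsInner e

open scoped Classical in
/-- A tropical cover `φ : C → Tℙ¹ = ℝ ∪ {±∞}`. As `φ` is affine linear on each edge, it is given by the
images `pos v` of the inner vertices and the slopes (weights) of the edges. Edges are oriented by `φ`:
`src e` is the endpoint with smaller image. Hence a leaf at the source (resp. target) of an edge is
mapped to `-∞` (resp. `+∞`). -/
structure TropicalCover extends TropicalCurve where
  pos : V → ℝ
  weight : E → ℕ
  weight_pos : ∀ e, 0 < weight e
  slope : ∀ e u v, src e = some u → tgt e = some v →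
    pos v - pos u = weight e * (length e).toReal
  balanced : ∀ v, (∑ e with tgt e = some v, weight e) = ∑ e with src e = some v, weight e

namespace TropicalCover

/-- Isomorphisms of tropical covers: isometries of the curves (leaves removed) compatible with
the maps to `Tℙ¹`. -/
structure Iso (C D : TropicalCover) where
  onV : C.V ≃ D.V
  onE : C.E ≃ D.E
  src_eq : ∀ e, D.src (onE e) = (C.src e).map onV
  tgt_eq : ∀ e, D.tgt (onE e) = (C.tgt e).map onV
  length_eq : ∀ e, D.length (onE e) = C.length e
  pos_eq : ∀ v, D.pos (onV v) = C.pos v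
  weight_eq : ∀ e, D.weight (onE e) = C.weight e

def Iso.refl (C : TropicalCover) : Iso C C where
  onV := Equiv.refl _
  onE := Equiv.refl _
  src_eq e := by simp
  tgt_eq e := by simp
  length_eq e := rfl
  pos_eq v := rfl
  weight_eq e := rfl

def Iso.symm {C D : TropicalCover} (f : Iso C D) : Iso D C where
  onV := f.onV.symm
  onE := f.onE.symm
  src_eq e := by
    have h := f.src_eq (f.onE.symm e)
    rw [Equiv.apply_symm_apply] at h
    simp [h, Option.map_map]
  tgt_eq e := by
    have h := f.tgt_eq (f.onE.symm e)
    rw [Equiv.apply_symm_apply] at h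
    simp [h, Option.map_map]
  length_eq e := by simpa using (f.length_eq (f.onE.symm e)).symm
  pos_eq v := by simpa using (f.pos_eq (f.onV.symm v)).symm
  weight_eq e := by simpa using (f.weight_eq (f.onE.symm e)).symm

def Iso.trans {C D F : TropicalCover} (f : Iso C D) (g : Iso D F) : Iso C F where
  onV := f.onV.trans g.onV
  onE := f.onE.trans g.onE
  src_eq e := by simp [g.src_eq, f.src_eq, Option.map_map]
  tgt_eq e := by simp [g.tgt_eq, f.tgt_eq, Option.map_map]
  length_eq e := by simp [g.length_eq, f.length_eq]
  pos_eq v := by simp [g.pos_eq, f.pos_eq]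
  weight_eq e := by simp [g.weight_eq, f.weight_eq]

instance isoSetoid : Setoid TropicalCover where
  r C D := Nonempty (Iso C D)
  iseqv :=
    { refl := fun C => ⟨Iso.refl C⟩
      symm := fun ⟨f⟩ => ⟨f.symm⟩
      trans := fun ⟨f⟩ ⟨g⟩ => ⟨f.trans g⟩ }

variable (C : TropicalCover)

open scoped Classical in
/-- The cover is of type `(g, lam, mu, z)`, where `z` is a set of simple branch points. -/
structure IsOfType (g : ℕ) (lam mu : Multiset ℕ) (z : Finset ℝ) : Prop where
  genus_eq : C.genus = g
  range_pos : Set.range C.pos = z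
  left_ends : (Finset.univ.filter fun e => C.src e = none).val.map C.weight = lam
  right_ends : (Finset.univ.filter fun e => C.tgt e = none).val.map C.weight = mu

/-- Two distinct edges of the same weight, adjacent to the same two inner vertices (a symmetric
cycle) or to the same inner vertex and ends otherwise (a symmetric fork; by balancing the two ends
of a symmetric fork point in the same direction). -/
def IsSymPair (e f : C.E) : Prop :=
  e ≠ f ∧ C.weight e = C.weight f ∧ C.src e = C.src f ∧ C.tgt e = C.tgt f ∧
    (C.src e ≠ none ∨ C.tgt e ≠ none)

/-- `Sym(φ)`: the set of symmetric cycles and symmetric forks. -/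
def sym : Set (Sym2 C.E) := {p | ∃ e f, p = s(e, f) ∧ C.IsSymPair e f}

/-- `Symc(φ)`: the set of symmetric cycles. -/
def symc : Set (Sym2 C.E) := {p | ∃ e f, p = s(e, f) ∧ C.IsSymPair e f ∧ C.IsInner e}

/-- A colouring of a tropical cover: a subset `I` of `Sym(φ)` and a colour (red or blue) for each
connected component of the subgraph of even edges not in the interior of an element of `I`.
For a cover with only simple branch points there are no contractible edges and no paired vertices,
so every colouring is effective. -/
structure Colouring where
  I : Set (Sym2 C.E)
  I_subset : I ⊆ C.sym
  colour : {e : C.E // Even (C.weight e) ∧ ∀ p ∈ I, e ∉ p} → Bool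
  colour_eq : ∀ e f v, C.Incident e.1 v → C.Incident f.1 v → colour e = colour f

variable {C} in
/-- The real multiplicity `2^|E(I)| / 2^|Sym(φ)| * ∏ ω(c)`, where `E(I)` is the set of inner edges of
even weight not in `I` and the product is over the symmetric cycles `c` in `I`, whose two edges
have the same weight `ω(c)`. (The further factors, concerning contractible edges and the symmetric
cycles and forks adjacent to them, are trivial for simple branch points.) -/
noncomputable def Colouring.mult (ρ : C.Colouring) : ℚ :=
  2 ^ Nat.card {e : C.E // C.IsInner e ∧ Even (C.weight e) ∧ ∀ p ∈ ρ.I, e ∉ p} / 2 ^ C.sym.ncard *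
    ∏ᶠ p ∈ C.symc ∩ ρ.I, ((p.map C.weight).inf : ℚ)

/-- The multiplicity is an odd integer for some effective colouring. -/
def HasOddMult : Prop := ∃ ρ : C.Colouring, ∃ k : ℤ, Odd k ∧ ρ.mult = k

/-- `IsBranch far near k e K`: the set of cells `K` is a tail made of edges of weight `2 * k` and
symmetric cycles and forks of weight `k`, and `e` is its edge next to the rest of the curve.
Here `near` and `far` give the endpoints of an edge towards the rest of the curve and away from it.
A tail starts with an end or with a symmetric fork, followed by any number of symmetric cycles;
the latter are allowed only for odd `k`. -/
inductive IsBranch (far near : C.E → Option C.V) (k : ℕ) : C.E → Set (C.V ⊕ C.E) → Prop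
  | leaf (e : C.E) : far e = none → C.weight e = 2 * k →
      IsBranch far near k e {Sum.inr e}
  | fork (e f f' : C.E) (w : C.V) : far e = some w → C.weight e = 2 * k → f ≠ f' →
      near f = some w → far f = none → C.weight f = k →
      near f' = some w → far f' = none → C.weight f' = k →
      IsBranch far near k e {Sum.inr e, Sum.inl w, Sum.inr f, Sum.inr f'}
  | cycle (a c c' e : C.E) (u w : C.V) (K : Set (C.V ⊕ C.E)) : Odd k →
      IsBranch far near k a K → near a = some u → c ≠ c' →
      far c = some u → near c = some w → C.weight c = k →
      far c' = some u → near c' = some w → C.weight c' = k →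
      far e = some w → C.weight e = 2 * k →
      IsBranch far near k e
        (K ∪ {Sum.inl u, Sum.inr c, Sum.inr c', Sum.inl w, Sum.inr e})

/-- `K` is an inward or an outward tail attached to the subgraph `S`. -/
def IsTail (S K : Set (C.V ⊕ C.E)) : Prop :=
  ∃ k e v, Sum.inl v ∈ S ∧
    ((C.IsBranch C.src C.tgt k e K ∧ C.tgt e = some v) ∨
      (C.IsBranch C.tgt C.src k e K ∧ C.src e = some v))

/-- `C` is a generalized zigzag cover (with simple branch points only) with respect to the set
of cells `S`. -/
structure IsZigzagFor (S : Set (C.V ⊕ C.E)) : Prop where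
  /-- `S` is a subgraph: it contains the endpoints of its edges. -/
  subgraph : ∀ e v, Sum.inr e ∈ S → C.Incident e v → Sum.inl v ∈ S
  connected : (C.cellGraph.induce S).Connected
  exists_vertex : ∃ v, Sum.inl v ∈ S
  /-- `S` is disjoint from the symmetric cycles and forks (edges and their inner vertices). -/
  disjoint_sym : ∀ p ∈ C.sym, ∀ e ∈ p, Sum.inr e ∉ S ∧ ∀ v, C.Incident e v → Sum.inl v ∉ S
  odd_edges : ∀ e, Sum.inr e ∈ S → Odd (C.weight e)
  /-- The connected components of the complement of `S` are tails. -/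
  tails : ∀ K : (C.cellGraph.induce Sᶜ).ConnectedComponent,
    C.IsTail S (Subtype.val '' K.supp)

/-- A generalized zigzag cover with simple branch points only. For such a cover there are no
contractible edges, so that all symmetric cycles and forks are non-contractible and not
adjacent to a contractible edge. -/
def IsGeneralizedZigzag : Prop := ∃ S, C.IsZigzagFor S

end TropicalCover

/-- The set of isomorphism classes of generalized zigzag covers of type `(g, lam, mu, z)`, for a
set `z` of simple branch points. -/
def zigzagClasses (g : ℕ) (lam mu : Multiset ℕ) (z : Finset ℝ) :
    Set (Quotient TropicalCover.isoSetoid) :=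
  {c | ∃ C : TropicalCover, ⟦C⟧ = c ∧ C.IsOfType g lam mu z ∧ C.IsGeneralizedZigzag}

open scoped Classical in
/-- The exponent `m(φ)`: it is `0` if the multiplicity is odd for an effective colouring
and `1` otherwise. -/
noncomputable def zigzagExponent (c : Quotient TropicalCover.isoSetoid) : ℕ :=
  if ∃ C : TropicalCover, ⟦C⟧ = c ∧ C.HasOddMult then 0 else 1

/-- The generalized zigzag number `Z_g(lam, mu; Λ_{0,r})` for a set `z` of `r` simple branch points:
the sum of `2 ^ m(φ)` over the isomorphism classes of generalized zigzag covers. The sum is taken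
in `ℝ≥0∞`, so that it has no junk value. -/
noncomputable def zigzagNumber (g : ℕ) (lam mu : Multiset ℕ) (z : Finset ℝ) : ℝ≥0∞ :=
  ∑' c : zigzagClasses g lam mu z, 2 ^ zigzagExponent c

/-- The partition `(lam, 1^n)`. -/
def addOnes (lam : Multiset ℕ) (n : ℕ) : Multiset ℕ := lam + Multiset.replicate n 1

open scoped Classical in
/-- The partition `lam_o` of the tail decomposition `(lam_oo², lam_ee², lam_o, lam_e)`: it consists of
the odd integers that appear an odd number of times in `lam`, each taken once. -/
noncomputable def oddTail (lam : Multiset ℕ) : Finset ℕ :=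
  lam.toFinset.filter fun a => Odd a ∧ Odd (lam.count a)

/-! For a generalized zigzag cover, the colouring with `I = ∅` has multiplicity `2 ^ (E - s)`, where
`E` counts the even inner edges and `s` the symmetric cycles and forks. In a tail each even inner
edge is preceded by exactly one symmetric cycle or fork, and each of these is followed by exactly
one even inner edge; hence `E = s` and the multiplicity is `1` (`IsZigzagFor.hasOddMult`). So every
class contributes `2 ^ 0`, the zigzag number counts isomorphism classes, and the theorem asks for an
injection between sets of classes.

The injection starts from covers all of whose ends have weight `1`, an odd number of them on each
side. An odd end outside the odd subgraph `S` belongs to a symmetric fork, and forks pair such ends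
off, so `S` has an end on either side (`IsZigzagFor.exists_end`). Such an end can be prolonged
beyond all branch points: let it stop at a new vertex where a further even end joins it or splits
off, split that even end into a fork if desired, or let `S` turn back. Each new vertex preserves the
genus and the zigzag property. It is the extreme vertex of the new cover, so deleting it recovers
the old cover up to isomorphism (`Attachment.iso_of_iso`), which gives injectivity. Moves on the
left are moves on the right conjugated by a reflection of the line, and two reflections transport
the branch points to any other set of the same size.

It remains to choose the moves. Write `λ = λ_o + T` and `μ = μ_o + U`, where `T` and `U` consist of
even parts and of pairs of equal parts, that is, of leaves and forks. By parity `(|λ_o|, |μ_o|)` is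
`(0,0)`, `(1,1)`, `(2,0)` or `(0,2)`. The two ends of `S` realize the odd parts, the tails realize
`T` and `U`, and forks of weight `1` supply the missing degree. The number of these forks does not
depend on `g` or on the initial cover, and it determines `N₀`. -/

namespace EndGraph

/-! ### Incidence graph of the cells -/

variable {G : EndGraph}

theorem cellGraph_adj {a b : G.V ⊕ G.E} : G.cellGraph.Adj a b ↔
    ∃ v e, G.Incident e v ∧ (a = Sum.inl v ∧ b = Sum.inr e ∨ a = Sum.inr e ∧ b = Sum.inl v) := by
  unfold cellGraph
  rw [SimpleGraph.fromRel_adj]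
  constructor
  · rintro ⟨-, ⟨v, e, rfl, rfl, h⟩ | ⟨v, e, rfl, rfl, h⟩⟩
    · exact ⟨v, e, h, Or.inl ⟨rfl, rfl⟩⟩
    · exact ⟨v, e, h, Or.inr ⟨rfl, rfl⟩⟩
  · rintro ⟨v, e, h, ⟨rfl, rfl⟩ | ⟨rfl, rfl⟩⟩
    · exact ⟨by simp, Or.inl ⟨v, e, rfl, rfl, h⟩⟩
    · exact ⟨by simp, Or.inr ⟨v, e, rfl, rfl, h⟩⟩

theorem adj_vertex_edge {v : G.V} {e : G.E} :
    G.cellGraph.Adj (Sum.inl v) (Sum.inr e) ↔ G.Incident e v := by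
  rw [cellGraph_adj]; simp

theorem adj_edge_vertex {v : G.V} {e : G.E} :
    G.cellGraph.Adj (Sum.inr e) (Sum.inl v) ↔ G.Incident e v := by
  rw [cellGraph_adj]; simp

theorem not_adj_vertices {u v : G.V} : ¬ G.cellGraph.Adj (Sum.inl u) (Sum.inl v) := by
  rw [cellGraph_adj]; simp

theorem not_adj_edges {e f : G.E} : ¬ G.cellGraph.Adj (Sum.inr e) (Sum.inr f) := by
  rw [cellGraph_adj]; simp

/-- The length of the edges of a graph determined by the slopes and the images of the vertices. -/
noncomputable def lengthOf (G : EndGraph) (pos : G.V → ℝ) (weight : G.E → ℕ) (e : G.E) : ℝ≥0∞ :=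
  match G.src e, G.tgt e with
  | some u, some v => ENNReal.ofReal ((pos v - pos u) / weight e)
  | _, _ => ⊤

end EndGraph

open scoped Classical in
/-- The tropical cover given by a graph, the images of its vertices and the slopes. -/
noncomputable def TropicalCover.ofGraph (G : EndGraph) (pos : G.V → ℝ) (weight : G.E → ℕ)
    (connected : G.cellGraph.Connected) (valence_eq : ∀ v, G.valence v = 3)
    (weight_pos : ∀ e, 0 < weight e)
    (pos_lt : ∀ e u v, G.src e = some u → G.tgt e = some v → pos u < pos v)
    (balanced : ∀ v, (∑ e with G.tgt e = some v, weight e) = ∑ e with G.src e = some v, weight e) :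
    TropicalCover where
  toEndGraph := G
  length := G.lengthOf pos weight
  connected := connected
  valence_eq := valence_eq
  length_ne_zero e := by
    unfold EndGraph.lengthOf
    have := pos_lt e
    have hw : (0 : ℝ) < weight e := by exact_mod_cast weight_pos e
    split
    · rename_i u v h1 h2
      have := div_pos (sub_pos.2 (this u v h1 h2)) hw
      simpa using this
    · simp
  length_eq_top e := by
    unfold EndGraph.lengthOf EndGraph.IsInner
    split
    · rename_i u v h1 h2
      simp [h1, h2]
    · rename_i h
      cases h1 : G.src e <;> cases h2 : G.tgt e <;> simp_all
  pos := pos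
  weight := weight
  weight_pos := weight_pos
  slope e u v hu hv := by
    have hw : (0 : ℝ) < weight e := by exact_mod_cast weight_pos e
    have hp := pos_lt e u v hu hv
    simp only [EndGraph.lengthOf, hu, hv]
    rw [ENNReal.toReal_ofReal (div_pos (sub_pos.2 hp) hw).le]
    field_simp
  balanced := balanced

/-! ### Basic geometry of covers and connectedness of tails -/

namespace TropicalCover

variable {C D : TropicalCover}

theorem pos_lt_pos {e : C.E} {u v : C.V} (hu : C.src e = some u) (hv : C.tgt e = some v) :
    C.pos u < C.pos v := by
  have hs := C.slope e u v hu hv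
  have hw : (0 : ℝ) < C.weight e := by exact_mod_cast C.weight_pos e
  have hl : 0 < (C.length e).toReal := by
    apply ENNReal.toReal_pos (C.length_ne_zero e)
    rw [Ne, C.length_eq_top e]
    simp [EndGraph.IsInner, hu, hv]
  have := mul_pos hw hl
  linarith

theorem not_loop {e : C.E} {v : C.V} (hu : C.src e = some v) (hv : C.tgt e = some v) : False :=
  lt_irrefl _ (pos_lt_pos hu hv)

/-- The lengths are determined by the remaining data, hence automatically preserved. -/
noncomputable def Iso.ofData (onV : C.V ≃ D.V) (onE : C.E ≃ D.E)
    (src_eq : ∀ e, D.src (onE e) = (C.src e).map onV)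
    (tgt_eq : ∀ e, D.tgt (onE e) = (C.tgt e).map onV)
    (pos_eq : ∀ v, D.pos (onV v) = C.pos v)
    (weight_eq : ∀ e, D.weight (onE e) = C.weight e) : Iso C D where
  onV := onV
  onE := onE
  src_eq := src_eq
  tgt_eq := tgt_eq
  length_eq e := by
    cases hs : C.src e with
    | none =>
      rw [(C.length_eq_top e).2 (by simp [EndGraph.IsInner, hs]),
        (D.length_eq_top _).2 (by simp [EndGraph.IsInner, src_eq, hs])]
    | some u =>
      cases ht : C.tgt e with
      | none =>
        rw [(C.length_eq_top e).2 (by simp [EndGraph.IsInner, ht]),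
          (D.length_eq_top _).2 (by simp [EndGraph.IsInner, tgt_eq, ht])]
      | some v =>
        have h1 := C.slope e u v hs ht
        have h2 := D.slope (onE e) (onV u) (onV v) (by simp [src_eq, hs]) (by simp [tgt_eq, ht])
        rw [pos_eq, pos_eq, weight_eq, h1] at h2
        have hw : (C.weight e : ℝ) ≠ 0 := by exact_mod_cast (C.weight_pos e).ne'
        have h3 := mul_left_cancel₀ hw h2
        rw [ENNReal.toReal_eq_toReal_iff' ] at h3
        · exact h3.symm
        · rw [Ne, C.length_eq_top]; simp [EndGraph.IsInner, hs, ht]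
        · rw [Ne, D.length_eq_top]; simp [EndGraph.IsInner, src_eq, tgt_eq, hs, ht]
  pos_eq := pos_eq
  weight_eq := weight_eq

/-- A curve with an inner vertex has no edge without inner vertices. -/
theorem exists_incident (v : C.V) (e : C.E) : ∃ u, C.Incident e u := by
  obtain ⟨w⟩ := C.connected.preconnected (Sum.inr e) (Sum.inl v)
  cases w with
  | cons h _ =>
    rw [EndGraph.cellGraph_adj] at h
    obtain ⟨u, f, hi, ⟨h1, -⟩ | ⟨h1, -⟩⟩ := h
    · cases h1
    · cases h1; exact ⟨u, hi⟩

/-- Positive slopes exclude loops, so the valence `3` counts distinct edges and leaves no room for a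
fourth one. -/
theorem eq_of_incident {v : C.V} {x y z a : C.E} (hx : C.Incident x v) (hy : C.Incident y v)
    (hz : C.Incident z v) (hxy : x ≠ y) (hxz : x ≠ z) (hyz : y ≠ z) (ha : C.Incident a v) :
    a = x ∨ a = y ∨ a = z := by
  classical
  have hval := C.valence_eq v
  unfold EndGraph.valence at hval
  rw [Nat.card_eq_fintype_card, Nat.card_eq_fintype_card, Fintype.card_subtype,
    Fintype.card_subtype, ← Finset.card_union_of_disjoint] at hval
  · by_contra! hne
    have hsub : ({a, x, y, z} : Finset C.E) ⊆
        (Finset.univ.filter fun e => C.src e = some v) ∪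
          Finset.univ.filter fun e => C.tgt e = some v := by
      intro b hb
      simp only [Finset.mem_insert, Finset.mem_singleton] at hb
      simp only [Finset.mem_union, Finset.mem_filter, Finset.mem_univ, true_and]
      rcases hb with rfl | rfl | rfl | rfl <;> assumption
    have := Finset.card_le_card hsub
    rw [hval, Finset.card_insert_of_notMem (by simp [hne]), Finset.card_insert_of_notMem
      (by simp [hxy, hxz]), Finset.card_insert_of_notMem (by simp [hyz])] at this
    simp at this
  · rw [Finset.disjoint_filter]
    intro e _ h1 h2
    exact not_loop h1 h2

theorem IsSymPair.symm {e f : C.E} (h : C.IsSymPair e f) : C.IsSymPair f e := by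
  obtain ⟨h1, h2, h3, h4, h5⟩ := h
  exact ⟨h1.symm, h2.symm, h3.symm, h4.symm, by rwa [← h3, ← h4]⟩

theorem mem_sym {e f : C.E} (h : C.IsSymPair e f) : s(e, f) ∈ C.sym := ⟨e, f, rfl, h⟩

theorem sym_disjoint_iff {S : Set (C.V ⊕ C.E)} :
    (∀ p ∈ C.sym, ∀ e ∈ p, Sum.inr e ∉ S ∧ ∀ v, C.Incident e v → Sum.inl v ∉ S) ↔
      ∀ e f, C.IsSymPair e f → Sum.inr e ∉ S ∧ ∀ v, C.Incident e v → Sum.inl v ∉ S := by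
  constructor
  · intro h e f hef
    exact h _ (mem_sym hef) e (by simp)
  · rintro h _ ⟨e, f, rfl, hef⟩ a ha
    rw [Sym2.mem_iff] at ha
    rcases ha with rfl | rfl
    · exact h _ _ hef
    · exact h _ _ hef.symm

theorem IsBranch.mem {far near : C.E → Option C.V} {k : ℕ} {e : C.E} {K : Set (C.V ⊕ C.E)}
    (h : C.IsBranch far near k e K) : Sum.inr e ∈ K := by
  cases h <;> simp

/-- The endpoints only have to be preserved on the edges of `K`: attaching a vertex changes the
target of one edge, and the tails that avoid this edge must still be transported. -/
theorem IsBranch.map {far near : C.E → Option C.V} {far' near' : D.E → Option D.V} {k : ℕ}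
    {e : C.E} {K : Set (C.V ⊕ C.E)} (φ : C.V → D.V) (ψ : C.E → D.E) (hψ : Function.Injective ψ)
    (hw : ∀ a, D.weight (ψ a) = C.weight a) (h : C.IsBranch far near k e K)
    (hfar : ∀ a, Sum.inr a ∈ K → far' (ψ a) = (far a).map φ)
    (hnear : ∀ a, Sum.inr a ∈ K → near' (ψ a) = (near a).map φ) :
    D.IsBranch far' near' k (ψ e) (Sum.map φ ψ '' K) := by
  induction h with
  | leaf e he hwe =>
    rw [Set.image_singleton]
    exact .leaf _ (by rw [hfar e (by simp), he]; rfl) (by rw [hw, hwe])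
  | fork e f f' w he hwe hff hf1 hf2 hf3 hf1' hf2' hf3' =>
    simp only [Set.image_insert_eq, Set.image_singleton, Sum.map_inl, Sum.map_inr]
    refine .fork _ _ _ (φ w) ?_ (by rw [hw, hwe]) (hψ.ne hff) ?_ ?_ (by rw [hw, hf3]) ?_ ?_
      (by rw [hw, hf3'])
    · rw [hfar e (by simp), he]; rfl
    · rw [hnear f (by simp), hf1]; rfl
    · rw [hfar f (by simp), hf2]; rfl
    · rw [hnear f' (by simp), hf1']; rfl
    · rw [hfar f' (by simp), hf2']; rfl
  | cycle a c c' e u w K hk ha hau hcc hc1 hc2 hc3 hc1' hc2' hc3' he hwe ih =>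
    rw [Set.image_union]
    simp only [Set.image_insert_eq, Set.image_singleton, Sum.map_inl, Sum.map_inr]
    have ih' := ih (fun b hb => hfar b (Or.inl hb)) (fun b hb => hnear b (Or.inl hb))
    refine .cycle (ψ a) _ _ _ (φ u) (φ w) _ hk ih' ?_ (hψ.ne hcc) ?_ ?_ (by rw [hw, hc3]) ?_ ?_
      (by rw [hw, hc3']) ?_ (by rw [hw, hwe])
    · rw [hnear a (Or.inl ha.mem), hau]; rfl
    · rw [hfar c (by simp), hc1]; rfl
    · rw [hnear c (by simp), hc2]; rfl
    · rw [hfar c' (by simp), hc1']; rfl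
    · rw [hnear c' (by simp), hc2']; rfl
    · rw [hfar e (by simp), he]; rfl

/-- Each piece added to a tail touches the preceding one, so every cell has a path inside the tail
to its last edge `e`. The ambient set `T` is later the complement of `S`. -/
theorem IsBranch.reachable {far near : C.E → Option C.V} {k : ℕ} {e : C.E}
    {K : Set (C.V ⊕ C.E)} (h : C.IsBranch far near k e K)
    (hfar : ∀ a w, far a = some w → C.Incident a w)
    (hnear : ∀ a w, near a = some w → C.Incident a w)
    (T : Set (C.V ⊕ C.E)) (hT : K ⊆ T) :
    ∀ y (hy : y ∈ K), (C.cellGraph.induce T).Reachable ⟨y, hT hy⟩ ⟨Sum.inr e, hT h.mem⟩ := by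
  have adj : ∀ {a w} (ha : Sum.inr a ∈ T) (hw : Sum.inl w ∈ T), C.Incident a w →
      (C.cellGraph.induce T).Reachable ⟨Sum.inl w, hw⟩ ⟨Sum.inr a, ha⟩ := by
    intro a w ha hw hi
    apply SimpleGraph.Adj.reachable
    simpa using EndGraph.adj_vertex_edge.2 hi
  induction h with
  | leaf e he hwe =>
    rintro y rfl
    exact SimpleGraph.Reachable.refl _
  | fork e f f' w he hwe hff hf1 hf2 hf3 hf1' hf2' hf3' =>
    have hwT : Sum.inl w ∈ T := hT (by simp)
    have heT : Sum.inr e ∈ T := hT (by simp)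
    have hwe' := adj heT hwT (hfar e w he)
    rintro y (rfl | rfl | rfl | rfl)
    · exact SimpleGraph.Reachable.refl _
    · exact hwe'
    · exact (adj (hT (by simp)) hwT (hnear _ _ hf1)).symm.trans hwe'
    · exact (adj (hT (by simp)) hwT (hnear _ _ hf1')).symm.trans hwe'
  | cycle a c c' e u w K hk ha hau hcc hc1 hc2 hc3 hc1' hc2' hc3' he hwe ih =>
    have huT : Sum.inl u ∈ T := hT (by simp)
    have hwT : Sum.inl w ∈ T := hT (by simp)
    have heT : Sum.inr e ∈ T := hT (by simp)
    have hcT : Sum.inr c ∈ T := hT (by simp)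
    have hcT' : Sum.inr c' ∈ T := hT (by simp)
    have hwe' := adj heT hwT (hfar e w he)
    have hce := (adj hcT hwT (hnear _ _ hc2)).symm.trans hwe'
    have hue := (adj hcT huT (hfar _ _ hc1)).trans hce
    rintro y (hy | rfl | rfl | rfl | rfl | rfl)
    · exact (ih (fun x hx => hT (Or.inl hx)) y hy).trans
        ((adj (hT (Or.inl ha.mem)) huT (hnear _ _ hau)).symm.trans hue)
    · exact hue
    · exact hce
    · exact (adj hcT' hwT (hnear _ _ hc2')).symm.trans hwe'
    · exact hwe'
    · exact SimpleGraph.Reachable.refl _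

theorem IsTail.reachable {S K T : Set (C.V ⊕ C.E)} (h : C.IsTail S K) (hT : K ⊆ T) {x y}
    (hx : x ∈ K) (hy : y ∈ K) :
    (C.cellGraph.induce T).Reachable ⟨x, hT hx⟩ ⟨y, hT hy⟩ := by
  obtain ⟨k, e, v, -, ⟨h, -⟩ | ⟨h, -⟩⟩ := h
  · have := h.reachable (fun a w h => Or.inl h) (fun a w h => Or.inr h) T hT
    exact (this x hx).trans (this y hy).symm
  · have := h.reachable (fun a w h => Or.inr h) (fun a w h => Or.inl h) T hT
    exact (this x hx).trans (this y hy).symm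

theorem mem_of_reachable {α : Type*} {G : SimpleGraph α} {K : Set α}
    (hK : ∀ y ∈ K, ∀ z, G.Adj y z → z ∈ K) {x y : α} (h : G.Reachable x y) (hx : x ∈ K) :
    y ∈ K := by
  rw [SimpleGraph.reachable_iff_reflTransGen] at h
  induction h with
  | refl => exact hx
  | tail _ h ih => exact hK _ ih _ h

/-- The components of the complement of `S` are tails if and only if this complement is covered by
tails without neighbours in it. -/
theorem tails_iff {S : Set (C.V ⊕ C.E)} :
    (∀ K : (C.cellGraph.induce Sᶜ).ConnectedComponent, C.IsTail S (Subtype.val '' K.supp)) ↔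
      ∀ x ∉ S, ∃ K, x ∈ K ∧ K ⊆ Sᶜ ∧ C.IsTail S K ∧
        ∀ y ∈ K, ∀ z ∉ S, C.cellGraph.Adj y z → z ∈ K := by
  constructor
  · intro h x hx
    refine ⟨Subtype.val '' ((C.cellGraph.induce Sᶜ).connectedComponentMk ⟨x, hx⟩).supp,
      ⟨⟨x, hx⟩, rfl, rfl⟩, ?_, h _, ?_⟩
    · rintro _ ⟨y, -, rfl⟩
      exact y.2
    · rintro _ ⟨y, hy, rfl⟩ z hz hyz
      refine ⟨⟨z, hz⟩, ?_, rfl⟩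
      rw [SimpleGraph.ConnectedComponent.mem_supp_iff] at hy ⊢
      rw [← hy, SimpleGraph.ConnectedComponent.eq]
      apply SimpleGraph.Adj.reachable
      simpa using hyz.symm
  · intro h K
    induction K using SimpleGraph.ConnectedComponent.ind with
    | h x =>
      obtain ⟨K, hxK, hKS, htail, hcl⟩ := h x.1 x.2
      convert htail
      ext y
      constructor
      · rintro ⟨y, hy, rfl⟩
        rw [SimpleGraph.ConnectedComponent.mem_supp_iff, SimpleGraph.ConnectedComponent.eq] at hy
        -- A set closed under adjacency within the complement contains the component of each of its
        -- points; connectedness of the tail gives the other inclusion.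
        exact mem_of_reachable (K := Subtype.val ⁻¹' K)
          (fun a ha z hz => hcl _ ha _ z.2 (by simpa using hz)) hy.symm hxK
      · intro hy
        refine ⟨⟨y, hKS hy⟩, ?_, rfl⟩
        rw [SimpleGraph.ConnectedComponent.mem_supp_iff, SimpleGraph.ConnectedComponent.eq]
        exact htail.reachable hKS hy hxK

theorem connected_of_hom {α β : Type*} {G : SimpleGraph α} {H : SimpleGraph β} (f : G →g H)
    (hG : G.Connected) (h : ∀ b, ∃ a, H.Reachable b (f a)) : H.Connected := by
  have : Nonempty β := hG.nonempty.map f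
  refine ⟨fun b c => ?_⟩
  obtain ⟨x, hx⟩ := h b
  obtain ⟨y, hy⟩ := h c
  exact hx.trans (((hG.preconnected x y).map f).trans hy.symm)

end TropicalCover

/-! ### Counts and weights as sums over edges -/

open scoped Classical in
/-- The value `m` if `p` holds and `0` otherwise. -/
noncomputable def valueIf {M : Type*} [Zero M] (p : Prop) (m : M) : M := if p then m else 0

theorem valueIf_true {M : Type*} [Zero M] (m : M) : valueIf True m = m := if_pos trivial

theorem valueIf_false {M : Type*} [Zero M] (m : M) : valueIf False m = 0 := if_neg id

/-- Valences, leaves, balancing and multisets of end weights all become sums over every edge, so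
that they split uniformly into old and new edges when a vertex is attached. -/
theorem sum_filter_eq_sum_valueIf {α M : Type*} [Fintype α] [AddCommMonoid M] (p : α → Prop)
    [DecidablePred p] (f : α → M) : ∑ a with p a, f a = ∑ a, valueIf (p a) (f a) := by
  rw [Finset.sum_filter]
  refine Finset.sum_congr rfl fun a _ => ?_
  by_cases h : p a <;> simp [valueIf, h]

theorem natCard_subtype_eq_sum {α : Type*} [Fintype α] (p : α → Prop) :
    Nat.card {a // p a} = ∑ a, valueIf (p a) 1 := by
  classical
  rw [Nat.card_eq_fintype_card, Fintype.card_subtype, Finset.card_eq_sum_ones,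
    sum_filter_eq_sum_valueIf]

theorem filter_val_map_eq_sum {α β : Type*} [Fintype α] (p : α → Prop) [DecidablePred p]
    (f : α → β) :
    (Finset.univ.filter p).val.map f = ∑ a, valueIf (p a) ({f a} : Multiset β) := by
  rw [← sum_filter_eq_sum_valueIf, Finset.sum_eq_multiset_sum]
  have := (Multiset.sum_map_singleton ((Finset.univ.filter p).val.map f)).symm
  rwa [Multiset.map_map] at this

/-! ### Attaching a trivalent vertex to a right end -/

namespace TropicalCover

variable {C D : TropicalCover}

/-- The data needed to let a right end `e` of `C` stop at a new vertex with image `x`, where two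
new ends start: a right end of weight `w₂`, and an end of weight `w₁`, to the left if `left` holds
and to the right otherwise. -/
structure Attachment (C : TropicalCover) where
  e : C.E
  left : Bool
  w₁ : ℕ
  w₂ : ℕ
  x : ℝ
  tgt_e : C.tgt e = none
  src_e : C.src e ≠ none
  pos_lt : ∀ v, C.pos v < x
  w₁_pos : 0 < w₁
  w₂_pos : 0 < w₂
  balance : C.weight e + (if left then w₁ else 0) = w₂ + (if left then 0 else w₁)

namespace Attachment

def newSrc (A : C.Attachment) : C.E ⊕ Bool → Option (C.V ⊕ Unit)
  | Sum.inl a => (C.src a).map Sum.inl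
  | Sum.inr false => if A.left then none else some (Sum.inr ())
  | Sum.inr true => some (Sum.inr ())

open scoped Classical in
noncomputable def newTgt (A : C.Attachment) : C.E ⊕ Bool → Option (C.V ⊕ Unit)
  | Sum.inl a => if a = A.e then some (Sum.inr ()) else (C.tgt a).map Sum.inl
  | Sum.inr false => if A.left then some (Sum.inr ()) else none
  | Sum.inr true => none

noncomputable abbrev graph (A : C.Attachment) : EndGraph where
  V := C.V ⊕ Unit
  E := C.E ⊕ Bool
  src := A.newSrc
  tgt := A.newTgt

def newWeight (A : C.Attachment) : C.E ⊕ Bool → ℕ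
  | Sum.inl a => C.weight a
  | Sum.inr false => A.w₁
  | Sum.inr true => A.w₂

def newPos (A : C.Attachment) : C.V ⊕ Unit → ℝ
  | Sum.inl v => C.pos v
  | Sum.inr _ => A.x

variable (A : C.Attachment)

theorem newSrc_inl (a : C.E) : A.newSrc (Sum.inl a) = (C.src a).map Sum.inl := rfl

theorem newSrc_false :
    A.newSrc (Sum.inr false) = if A.left then none else some (Sum.inr ()) := rfl

theorem newSrc_true : A.newSrc (Sum.inr true) = some (Sum.inr ()) := rfl

theorem newTgt_self : A.newTgt (Sum.inl A.e) = some (Sum.inr ()) := by simp [newTgt]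

theorem newTgt_of_ne {a : C.E} (h : a ≠ A.e) :
    A.newTgt (Sum.inl a) = (C.tgt a).map Sum.inl := by simp [newTgt, h]

theorem newTgt_false :
    A.newTgt (Sum.inr false) = if A.left then some (Sum.inr ()) else none := rfl

theorem newTgt_true : A.newTgt (Sum.inr true) = none := rfl

theorem newTgt_eq_some_inl {a : C.E} {v : C.V} :
    A.newTgt (Sum.inl a) = some (Sum.inl v) ↔ C.tgt a = some v := by
  by_cases h : a = A.e
  · subst h; simp [newTgt_self, A.tgt_e]
  · simp [newTgt_of_ne, h]

theorem newTgt_eq_some_inr {a : C.E} {v : Unit} :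
    A.newTgt (Sum.inl a) = some (Sum.inr v) ↔ a = A.e := by
  by_cases h : a = A.e
  · subst h; simp [newTgt_self]
  · simp [newTgt_of_ne, h]

theorem newTgt_eq_none {a : C.E} :
    A.newTgt (Sum.inl a) = none ↔ a ≠ A.e ∧ C.tgt a = none := by
  by_cases h : a = A.e
  · subst h; simp [newTgt_self]
  · simp [newTgt_of_ne, h]

theorem newSrc_eq_some_inl {a : C.E} {v : C.V} :
    A.newSrc (Sum.inl a) = some (Sum.inl v) ↔ C.src a = some v := by
  simp [newSrc_inl]

theorem newSrc_eq_some_inr {a : C.E} {v : Unit} :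
    A.newSrc (Sum.inl a) ≠ some (Sum.inr v) := by
  simp [newSrc_inl]

theorem newSrc_eq_none {a : C.E} : A.newSrc (Sum.inl a) = none ↔ C.src a = none := by
  simp [newSrc_inl]

theorem incident_inl {a : C.E} {v : C.V} :
    A.graph.Incident (Sum.inl a) (Sum.inl v) ↔ C.Incident a v := by
  simp [EndGraph.Incident, newSrc_eq_some_inl, newTgt_eq_some_inl]

theorem incident_inl_inr {a : C.E} {v : Unit} :
    A.graph.Incident (Sum.inl a) (Sum.inr v) ↔ a = A.e := by
  simp [EndGraph.Incident, newSrc_eq_some_inr, newTgt_eq_some_inr]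

theorem incident_inr {b : Bool} {v : Unit} : A.graph.Incident (Sum.inr b) (Sum.inr v) := by
  cases b <;> cases h : A.left <;>
    simp [EndGraph.Incident, newSrc_true, newSrc_false, newTgt_false, h]

theorem not_incident_inr_inl {b : Bool} {v : C.V} :
    ¬ A.graph.Incident (Sum.inr b) (Sum.inl v) := by
  cases b <;> cases h : A.left <;>
    simp [EndGraph.Incident, newSrc_true, newTgt_true, newSrc_false, newTgt_false, h]

/-- The cells of `C` as cells of the extended curve. -/
def cell (A : C.Attachment) : C.V ⊕ C.E → A.graph.V ⊕ A.graph.E := Sum.map Sum.inl Sum.inl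

theorem adj_cell {a b : C.V ⊕ C.E} :
    A.graph.cellGraph.Adj (A.cell a) (A.cell b) ↔ C.cellGraph.Adj a b := by
  rcases a with a | a <;> rcases b with b | b
  · exact iff_of_false EndGraph.not_adj_vertices EndGraph.not_adj_vertices
  · exact EndGraph.adj_vertex_edge.trans (A.incident_inl.trans EndGraph.adj_vertex_edge.symm)
  · exact EndGraph.adj_edge_vertex.trans (A.incident_inl.trans EndGraph.adj_edge_vertex.symm)
  · exact iff_of_false EndGraph.not_adj_edges EndGraph.not_adj_edges

def cellHom (A : C.Attachment) : C.cellGraph →g A.graph.cellGraph where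
  toFun := A.cell
  map_rel' h := A.adj_cell.2 h

theorem connected : A.graph.cellGraph.Connected := by
  refine connected_of_hom A.cellHom C.connected ?_
  have hv : A.graph.cellGraph.Reachable (Sum.inl (Sum.inr ())) (A.cell (Sum.inr A.e)) :=
    (EndGraph.adj_vertex_edge.2 (A.incident_inl_inr.2 rfl)).reachable
  rintro ((v | v) | (a | b))
  · exact ⟨Sum.inl v, .refl _⟩
  · exact ⟨Sum.inr A.e, hv⟩
  · exact ⟨Sum.inr a, .refl _⟩
  · exact ⟨Sum.inr A.e, ((EndGraph.adj_edge_vertex.2 A.incident_inr).reachable).trans hv⟩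

theorem sum_newEdges {M : Type*} [AddCommMonoid M] (f : C.E ⊕ Bool → M) :
    ∑ a, f a = ∑ a, f (Sum.inl a) + (f (Sum.inr true) + f (Sum.inr false)) := by
  rw [Fintype.sum_sum_type, Fintype.sum_bool]

/-- Among the old edges, only `A.e` ceases to be a right end. -/
theorem sum_tgt_none {M : Type*} [AddCommMonoid M] (f : C.E → M) :
    ∑ a, valueIf (C.tgt a = none) (f a) =
      f A.e + ∑ a, valueIf (A.newTgt (Sum.inl a) = none) (f a) := by
  classical
  have h : f A.e = ∑ a, if a = A.e then f a else 0 := by simp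
  rw [h, ← Finset.sum_add_distrib]
  refine Finset.sum_congr rfl fun a _ => ?_
  by_cases ha : a = A.e
  · subst ha; simp [A.tgt_e, newTgt_self, valueIf_true, valueIf_false]
  · simp [newTgt_eq_none, ha]

theorem valence_eq (v : C.V ⊕ Unit) : A.graph.valence v = 3 := by
  unfold EndGraph.valence
  rw [natCard_subtype_eq_sum, natCard_subtype_eq_sum, sum_newEdges, sum_newEdges]
  rcases v with v | v
  · have := C.valence_eq v
    unfold EndGraph.valence at this
    rw [natCard_subtype_eq_sum, natCard_subtype_eq_sum] at this
    cases h : A.left <;> simpa [newTgt_eq_some_inl, newSrc_eq_some_inl, valueIf_false,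
      newSrc_false, newTgt_false, newSrc_true, newTgt_true, h] using this
  · have : ∑ a, valueIf (a = A.e) 1 = 1 := by classical simp [valueIf]
    cases h : A.left <;> simp [newTgt_eq_some_inr, newSrc_eq_some_inr, valueIf_false, valueIf_true,
      newSrc_false, newTgt_false, newSrc_true, newTgt_true, h, this]

theorem numLeaves_eq : A.graph.numLeaves = C.numLeaves + 1 := by
  unfold EndGraph.numLeaves
  have := A.sum_tgt_none (fun _ => 1)
  rw [natCard_subtype_eq_sum, natCard_subtype_eq_sum, natCard_subtype_eq_sum,
    natCard_subtype_eq_sum, this, sum_newEdges, sum_newEdges]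
  cases h : A.left <;> simp [newSrc_eq_none, valueIf_false, valueIf_true,
      newSrc_false, newTgt_false, newSrc_true, newTgt_true, h] <;> omega

theorem genus_eq : A.graph.genus = C.genus := by
  unfold EndGraph.genus
  rw [numLeaves_eq, Fintype.card_sum, Fintype.card_sum]
  simp
  ring

open scoped Classical in
theorem balanced (v : C.V ⊕ Unit) : (∑ a with A.newTgt a = some v, A.newWeight a) =
    ∑ a with A.newSrc a = some v, A.newWeight a := by
  rw [sum_filter_eq_sum_valueIf, sum_filter_eq_sum_valueIf, sum_newEdges, sum_newEdges]
  rcases v with v | v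
  · have := C.balanced v
    rw [sum_filter_eq_sum_valueIf, sum_filter_eq_sum_valueIf] at this
    cases h : A.left <;> simpa [newTgt_eq_some_inl, newSrc_eq_some_inl, valueIf_false,
      newSrc_false, newTgt_false, newSrc_true, newTgt_true, h, newWeight] using this
  · have h1 := A.balance
    have : ∑ a, valueIf (a = A.e) (C.weight a) = C.weight A.e := by classical simp [valueIf]
    cases h : A.left <;> simpa [newTgt_eq_some_inr, newSrc_eq_some_inr, valueIf_false,
      valueIf_true, newSrc_false, newTgt_false, newSrc_true, newTgt_true, h, newWeight, this]
        using h1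

/-- The extended tropical cover. -/
noncomputable def cover : TropicalCover :=
  ofGraph A.graph A.newPos A.newWeight A.connected A.valence_eq
    (by
      rintro (a | _ | _)
      · exact C.weight_pos a
      · exact A.w₁_pos
      · exact A.w₂_pos)
    (by
      rintro (a | _ | _) u v hu hv
      · rcases u with u | u
        · rcases v with v | v
          · exact pos_lt_pos (A.newSrc_eq_some_inl.1 hu) (A.newTgt_eq_some_inl.1 hv)
          · exact A.pos_lt u
        · exact absurd hu A.newSrc_eq_some_inr
      · cases h : A.left <;> simp [newSrc_false, newTgt_false, h] at hu hv
      · cases hv)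
    (by convert A.balanced)

theorem isOfType {g : ℕ} {L M : Multiset ℕ} {z : Finset ℝ}
    (h : C.IsOfType g L (C.weight A.e ::ₘ M) z) :
    A.cover.IsOfType g (if A.left then A.w₁ ::ₘ L else L)
      (if A.left then A.w₂ ::ₘ M else A.w₁ ::ₘ A.w₂ ::ₘ M) (insert A.x z) := by
  refine ⟨A.genus_eq.trans h.genus_eq, ?_, ?_, ?_⟩
  · have : Set.range A.cover.pos = insert A.x (Set.range C.pos) := by
      ext y
      constructor
      · rintro ⟨v | v, rfl⟩
        · exact Or.inr ⟨v, rfl⟩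
        · exact Or.inl rfl
      · rintro (rfl | ⟨v, rfl⟩)
        · exact ⟨Sum.inr (), rfl⟩
        · exact ⟨Sum.inl v, rfl⟩
    rw [this, h.range_pos, Finset.coe_insert]
  · have hL := h.left_ends
    rw [filter_val_map_eq_sum] at hL ⊢
    refine (sum_newEdges (C := C) (fun a => valueIf (A.newSrc a = none) {A.newWeight a})).trans ?_
    cases h : A.left <;> simp [newWeight, hL, newSrc_eq_none, newSrc_false, newSrc_true, h,
      valueIf_false, valueIf_true, ← Multiset.singleton_add, add_comm]
  · have hM := h.right_ends
    rw [filter_val_map_eq_sum] at hM ⊢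
    have h2 := (A.sum_tgt_none (fun a => ({C.weight a} : Multiset ℕ))).symm.trans hM
    rw [← Multiset.singleton_add] at h2
    have h3 := add_left_cancel h2
    refine (sum_newEdges (C := C) (fun a => valueIf (A.newTgt a = none) {A.newWeight a})).trans ?_
    simp only [newWeight]
    rw [h3]
    cases h : A.left <;> simp [newTgt_false, newTgt_true, h,
      valueIf_false, valueIf_true, ← Multiset.singleton_add, add_comm, add_left_comm]

/-! ### Zigzag structure of the extended cover -/

theorem cell_injective : Function.Injective A.cell :=
  Sum.map_injective.2 ⟨Sum.inl_injective, Sum.inl_injective⟩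

/-- The only symmetric pair that an attachment can create is the fork of the two new ends. An old
and a new edge never share both endpoints: the only old edge at the new vertex is `A.e`, whose
source is an old vertex. -/
theorem isSymPair_cases {a b : C.E ⊕ Bool} (h : A.cover.IsSymPair a b) :
    (∃ a' b', a = Sum.inl a' ∧ b = Sum.inl b' ∧ C.IsSymPair a' b') ∨
      ((∃ c, a = Sum.inr c) ∧ (∃ c, b = Sum.inr c) ∧ A.left = false ∧ A.w₁ = A.w₂) := by
  have mixed : ∀ a' c, ¬ A.cover.IsSymPair (Sum.inl a' : C.E ⊕ Bool) (Sum.inr c : C.E ⊕ Bool) := by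
    rintro a' c ⟨-, -, hs, ht, -⟩
    replace hs : A.newSrc (Sum.inl a') = A.newSrc (Sum.inr c) := hs
    replace ht : A.newTgt (Sum.inl a') = A.newTgt (Sum.inr c) := ht
    cases c
    · cases hl : A.left
      · rw [newSrc_false, hl] at hs
        exact A.newSrc_eq_some_inr hs
      · rw [newTgt_false, hl] at ht
        obtain rfl := A.newTgt_eq_some_inr.1 ht
        rw [newSrc_false, hl] at hs
        exact A.src_e (A.newSrc_eq_none.1 hs)
    · exact A.newSrc_eq_some_inr hs
  rcases a with a | c <;> rcases b with b | c'
  · left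
    refine ⟨a, b, rfl, rfl, ?_⟩
    obtain ⟨hne, hw, hs, ht, hi⟩ := h
    replace hne : a ≠ b := fun h => hne (congrArg _ h)
    replace hw : C.weight a = C.weight b := hw
    replace hs : A.newSrc (Sum.inl a) = A.newSrc (Sum.inl b) := hs
    replace ht : A.newTgt (Sum.inl a) = A.newTgt (Sum.inl b) := ht
    replace hi : A.newSrc (Sum.inl a) ≠ none ∨ A.newTgt (Sum.inl a) ≠ none := hi
    have ha : a ≠ A.e := by
      rintro rfl
      rw [newTgt_self] at ht
      exact hne (A.newTgt_eq_some_inr.1 ht.symm).symm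
    have hb : b ≠ A.e := by
      rintro rfl
      rw [newTgt_self] at ht
      exact hne (A.newTgt_eq_some_inr.1 ht)
    rw [newTgt_of_ne _ ha, newTgt_of_ne _ hb] at ht
    rw [newTgt_of_ne _ ha] at hi
    exact ⟨hne, hw, Option.map_injective Sum.inl_injective hs,
      Option.map_injective Sum.inl_injective ht, by simpa [newSrc_inl] using hi⟩
  · exact absurd h (mixed _ _)
  · exact absurd h.symm (mixed _ _)
  · right
    refine ⟨⟨c, rfl⟩, ⟨c', rfl⟩, ?_⟩
    obtain ⟨hne, hw, hs, ht, -⟩ := h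
    replace hw : A.newWeight (Sum.inr c) = A.newWeight (Sum.inr c') := hw
    replace ht : A.newTgt (Sum.inr c) = A.newTgt (Sum.inr c') := ht
    have hl : A.left = false := by
      by_contra hl
      rw [Bool.not_eq_false] at hl
      cases c <;> cases c' <;> first | exact hne rfl | simp [newTgt_false, newTgt_true, hl] at ht
    refine ⟨hl, ?_⟩
    cases c <;> cases c'
    · exact absurd rfl hne
    · exact hw
    · exact hw.symm
    · exact absurd rfl hne

/-- A component avoiding `A.e` survives unchanged, since `A.e` is the only old cell whose neighbours
change. -/
theorem exists_tail_cell {S : Set (C.V ⊕ C.E)} {S' : Set (A.cover.V ⊕ A.cover.E)}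
    (hS' : ∀ y, A.cell y ∈ S' ↔ y ∈ S) {x : C.V ⊕ C.E} {K : Set (C.V ⊕ C.E)}
    (hxK : x ∈ K) (hKS : K ⊆ Sᶜ) (hK : C.IsTail S K)
    (hcl : ∀ y ∈ K, ∀ z ∉ S, C.cellGraph.Adj y z → z ∈ K) (he : Sum.inr A.e ∉ K) :
    ∃ K', A.cell x ∈ K' ∧ K' ⊆ S'ᶜ ∧ A.cover.IsTail S' K' ∧
      ∀ y ∈ K', ∀ z ∉ S', A.cover.cellGraph.Adj y z → z ∈ K' := by
  have hne : ∀ {a}, Sum.inr a ∈ K → a ≠ A.e := by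
    rintro a ha rfl
    exact he ha
  refine ⟨A.cell '' K, ⟨x, hxK, rfl⟩, ?_, ?_, ?_⟩
  · rintro _ ⟨y, hy, rfl⟩ hyS
    exact hKS hy ((hS' y).1 hyS)
  · obtain ⟨k, e, v, hv, ⟨hb, hev⟩ | ⟨hb, hev⟩⟩ := hK
    · refine ⟨k, Sum.inl e, Sum.inl v, (hS' (Sum.inl v)).2 hv, Or.inl ⟨?_, ?_⟩⟩
      · exact hb.map (D := A.cover) Sum.inl Sum.inl Sum.inl_injective (fun a => rfl)
          (fun a _ => rfl) (fun a ha => A.newTgt_of_ne (hne ha))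
      · exact A.newTgt_eq_some_inl.2 hev
    · refine ⟨k, Sum.inl e, Sum.inl v, (hS' (Sum.inl v)).2 hv, Or.inr ⟨?_, ?_⟩⟩
      · exact hb.map (D := A.cover) Sum.inl Sum.inl Sum.inl_injective (fun a => rfl)
          (fun a ha => A.newTgt_of_ne (hne ha)) (fun a _ => rfl)
      · exact A.newSrc_eq_some_inl.2 hev
  · rintro _ ⟨y, hy, rfl⟩ z hz hyz
    replace hyz : A.graph.cellGraph.Adj (A.cell y) z := hyz
    rcases z with (v | v) | (a | b)
    · exact ⟨Sum.inl v, hcl y hy _ (fun h => hz ((hS' _).2 h)) (A.adj_cell.1 hyz), rfl⟩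
    · rcases y with y | y
      · exact absurd hyz EndGraph.not_adj_vertices
      · exact absurd (A.incident_inl_inr.1 (EndGraph.adj_edge_vertex.1 hyz)) (hne hy)
    · exact ⟨Sum.inr a, hcl y hy _ (fun h => hz ((hS' _).2 h)) (A.adj_cell.1 hyz), rfl⟩
    · rcases y with y | y
      · exact absurd (EndGraph.adj_vertex_edge.1 hyz) A.not_incident_inr_inl
      · exact absurd hyz EndGraph.not_adj_edges

/-- The subgraph `S` with the new vertex and the new edge of index `b` added. -/
def extend (S : Set (C.V ⊕ C.E)) (b : Bool) : Set (A.cover.V ⊕ A.cover.E) :=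
  A.cell '' S ∪ {Sum.inl (Sum.inr ()), Sum.inr (Sum.inr b)}

theorem cell_mem_extend {S : Set (C.V ⊕ C.E)} {b : Bool} {y : C.V ⊕ C.E} :
    A.cell y ∈ A.extend S b ↔ y ∈ S := by
  constructor
  · rintro (h | h | h)
    · exact A.cell_injective.mem_set_image.1 h
    all_goals rcases y with y | y <;> cases h
  · exact fun h => Or.inl ⟨y, h, rfl⟩

theorem new_edge_mem_extend {S : Set (C.V ⊕ C.E)} {b c : Bool} :
    (Sum.inr (Sum.inr c) : A.cover.V ⊕ A.cover.E) ∈ A.extend S b ↔ c = b := by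
  constructor
  · rintro (⟨y | y, -, hy⟩ | hy | hy)
    · cases hy
    · cases hy
    · cases hy
    · cases hy; rfl
  · rintro rfl
    exact Or.inr (Or.inr rfl)

theorem new_vertex_mem_extend (S : Set (C.V ⊕ C.E)) (b : Bool) :
    (Sum.inl (Sum.inr ()) : A.cover.V ⊕ A.cover.E) ∈ A.extend S b := Or.inr (Or.inl rfl)

/-- Attaching an even end to an end of the subgraph `S` yields a generalized zigzag cover. -/
theorem isZigzagFor_extend {S : Set (C.V ⊕ C.E)} (hS : C.IsZigzagFor S) (he : Sum.inr A.e ∈ S)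
    (b : Bool) (hodd : Odd (A.newWeight (Sum.inr b))) (heven : Even (A.newWeight (Sum.inr !b))) :
    A.cover.IsZigzagFor (A.extend S b) := by
  have hv := A.new_vertex_mem_extend S b
  refine ⟨?_, ?_, ⟨_, hv⟩, ?_, ?_, ?_⟩
  · rintro (a | c) (v | v) h hi
    · exact A.cell_mem_extend.2 (hS.subgraph a v (A.cell_mem_extend.1 h) (A.incident_inl.1 hi))
    · exact hv
    · exact absurd hi A.not_incident_inr_inl
    · exact hv
  · let f : C.cellGraph.induce S →g A.cover.cellGraph.induce (A.extend S b) :=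
      { toFun := fun x => ⟨A.cell x.1, A.cell_mem_extend.2 x.2⟩
        map_rel' := fun {x y} h => by
          have h' : C.cellGraph.Adj x.1 y.1 := SimpleGraph.comap_adj.1 h
          exact SimpleGraph.comap_adj.2 (A.adj_cell.2 h') }
    refine connected_of_hom f hS.connected ?_
    have h1 : (A.cover.cellGraph.induce (A.extend S b)).Reachable
        ⟨Sum.inl (Sum.inr ()), hv⟩ (f ⟨_, he⟩) := by
      apply SimpleGraph.Adj.reachable
      have : A.cover.cellGraph.Adj (Sum.inl (Sum.inr ())) (Sum.inr (Sum.inl A.e)) :=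
        EndGraph.adj_vertex_edge.2 (A.incident_inl_inr.2 rfl)
      exact SimpleGraph.comap_adj.2 this
    rintro ⟨x, ⟨y, hy, rfl⟩ | rfl | rfl⟩
    · exact ⟨⟨y, hy⟩, .refl _⟩
    · exact ⟨⟨_, he⟩, h1⟩
    · refine ⟨⟨_, he⟩, SimpleGraph.Reachable.trans (SimpleGraph.Adj.reachable ?_) h1⟩
      have : A.cover.cellGraph.Adj (Sum.inr (Sum.inr b)) (Sum.inl (Sum.inr ())) :=
        EndGraph.adj_edge_vertex.2 A.incident_inr
      exact SimpleGraph.comap_adj.2 this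
  · rw [sym_disjoint_iff]
    intro a c hac
    rcases A.isSymPair_cases hac with ⟨a', c', rfl, rfl, h⟩ | ⟨-, -, -, hw⟩
    · have hd := sym_disjoint_iff.1 hS.disjoint_sym a' c' h
      refine ⟨fun h => hd.1 (A.cell_mem_extend.1 h), ?_⟩
      rintro (v | v) hi
      · exact fun h => hd.2 v (A.incident_inl.1 hi) (A.cell_mem_extend.1 h)
      · obtain rfl := A.incident_inl_inr.1 hi
        exact absurd he hd.1
    · exfalso
      -- The two new ends have different parity, so they do not form a fork.
      have : A.newWeight (Sum.inr b) = A.newWeight (Sum.inr !b) := by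
        cases b
        · exact hw
        · exact hw.symm
      rw [this] at hodd
      exact Nat.not_even_iff_odd.2 hodd heven
  · rintro (a | c) h
    · exact hS.odd_edges a (A.cell_mem_extend.1 h)
    · obtain rfl := A.new_edge_mem_extend.1 h
      exact hodd
  · rw [tails_iff]
    have old : ∀ x ∉ S, ∃ K', A.cell x ∈ K' ∧ K' ⊆ (A.extend S b)ᶜ ∧
        A.cover.IsTail (A.extend S b) K' ∧
        ∀ y ∈ K', ∀ z ∉ A.extend S b, A.cover.cellGraph.Adj y z → z ∈ K' := by
      intro x hx
      obtain ⟨K, hxK, hKS, hK, hcl⟩ := tails_iff.1 hS.tails x hx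
      exact A.exists_tail_cell (fun y => A.cell_mem_extend) hxK hKS hK hcl fun h => hKS h he
    rintro ((v | v) | (a | c)) hx
    · exact old (Sum.inl v) fun h => hx (A.cell_mem_extend.2 h)
    · exact absurd hv hx
    · exact old (Sum.inr a) fun h => hx (A.cell_mem_extend.2 h)
    · have hc : c = !b := by
        rw [new_edge_mem_extend] at hx
        cases b <;> cases c <;> simp_all
      subst hc
      -- The even new end is a component by itself: its only vertex is the new one, which lies in
      -- the extended subgraph.
      refine ⟨{Sum.inr (Sum.inr !b)}, rfl, ?_, ?_, ?_⟩
      · rintro _ rfl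
        exact hx
      · obtain ⟨k, hk⟩ := heven
        refine ⟨k, Sum.inr !b, Sum.inr (), hv, ?_⟩
        have hw : A.cover.weight (Sum.inr !b) = 2 * k := hk.trans (two_mul k).symm
        cases hl : A.left
        · right
          have h1 : A.newTgt (Sum.inr !b) = none := by
            cases b
            · rfl
            · simp [newTgt_false, hl]
          have h2 : A.newSrc (Sum.inr !b) = some (Sum.inr ()) := by
            cases b
            · rfl
            · simp [newSrc_false, hl]
          exact ⟨.leaf _ h1 hw, h2⟩
        · cases b
          · right
            exact ⟨.leaf _ rfl hw, rfl⟩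
          · left
            exact ⟨.leaf _ (show A.newSrc (Sum.inr false) = none by simp [newSrc_false, hl]) hw,
              show A.newTgt (Sum.inr false) = some (Sum.inr ()) by simp [newTgt_false, hl]⟩
      · rintro _ rfl ((v | v) | z) hz h
        · exact absurd (EndGraph.adj_edge_vertex.1 h) A.not_incident_inr_inl
        · exact absurd hv hz
        · exact absurd h EndGraph.not_adj_edges

/-- Splitting an even end attached to the subgraph `S` into a symmetric fork yields a generalized
zigzag cover. -/
theorem isZigzagFor_fork {S : Set (C.V ⊕ C.E)} (hS : C.IsZigzagFor S) {u : C.V}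
    (hu : C.src A.e = some u) (huS : Sum.inl u ∈ S) (hl : A.left = false) (hw : A.w₁ = A.w₂) :
    A.cover.IsZigzagFor (A.cell '' S) := by
  have hwe : C.weight A.e = 2 * A.w₂ := by
    have := A.balance
    simp only [hl, hw] at this
    simp at this
    omega
  have heS : Sum.inr A.e ∉ S := by
    intro h
    have := hS.odd_edges _ h
    rw [hwe] at this
    exact Nat.not_even_iff_odd.2 this (even_two_mul _)
  have hmem : ∀ y, A.cell y ∈ A.cell '' S ↔ y ∈ S := fun y => A.cell_injective.mem_set_image
  have hvS : (Sum.inl (Sum.inr ()) : A.cover.V ⊕ A.cover.E) ∉ A.cell '' S := by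
    rintro ⟨y | y, -, hy⟩ <;> cases hy
  have hbS : ∀ c, (Sum.inr (Sum.inr c) : A.cover.V ⊕ A.cover.E) ∉ A.cell '' S := by
    rintro c ⟨y | y, -, hy⟩ <;> cases hy
  refine ⟨?_, ?_, ?_, ?_, ?_, ?_⟩
  · rintro (a | c) (v | v) h hi
    · exact (hmem _).2 (hS.subgraph a v ((hmem (Sum.inr a)).1 h) (A.incident_inl.1 hi))
    · obtain rfl := A.incident_inl_inr.1 hi
      exact absurd ((hmem (Sum.inr A.e)).1 h) heS
    · exact absurd hi A.not_incident_inr_inl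
    · exact absurd h (hbS c)
  · let f : C.cellGraph.induce S →g A.cover.cellGraph.induce (A.cell '' S) :=
      { toFun := fun x => ⟨A.cell x.1, (hmem _).2 x.2⟩
        map_rel' := fun {x y} h => by
          have h' : C.cellGraph.Adj x.1 y.1 := SimpleGraph.comap_adj.1 h
          exact SimpleGraph.comap_adj.2 (A.adj_cell.2 h') }
    refine connected_of_hom f hS.connected ?_
    rintro ⟨_, ⟨y, hy, rfl⟩⟩
    exact ⟨⟨y, hy⟩, .refl _⟩
  · exact ⟨Sum.inl u, (hmem (Sum.inl u)).2 huS⟩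
  · rw [sym_disjoint_iff]
    intro a c hac
    rcases A.isSymPair_cases hac with ⟨a', c', rfl, rfl, h⟩ | ⟨⟨a, rfl⟩, -, -, -⟩
    · have hd := sym_disjoint_iff.1 hS.disjoint_sym a' c' h
      refine ⟨fun h => hd.1 ((hmem (Sum.inr a')).1 h), ?_⟩
      rintro (v | v) hi
      · exact fun h => hd.2 v (A.incident_inl.1 hi) ((hmem (Sum.inl v)).1 h)
      · exact hvS
    · refine ⟨hbS a, ?_⟩
      rintro (v | v) hi
      · exact absurd hi A.not_incident_inr_inl
      · exact hvS
  · rintro (a | c) h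
    · exact hS.odd_edges a ((hmem (Sum.inr a)).1 h)
    · exact absurd h (hbS c)
  · rw [tails_iff]
    -- The one-edge tail `A.e` becomes the stem of a fork, and these four cells form one component.
    have new : ∀ x ∈ ({Sum.inr (Sum.inl A.e), Sum.inl (Sum.inr ()), Sum.inr (Sum.inr false),
          Sum.inr (Sum.inr true)} : Set (A.cover.V ⊕ A.cover.E)),
        ∃ K', x ∈ K' ∧ K' ⊆ (A.cell '' S)ᶜ ∧
        A.cover.IsTail (A.cell '' S) K' ∧
        ∀ y ∈ K', ∀ z ∉ A.cell '' S, A.cover.cellGraph.Adj y z → z ∈ K' := by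
      intro x hx
      refine ⟨_, hx, ?_, ?_, ?_⟩
      · rintro _ (rfl | rfl | rfl | rfl)
        · exact fun h => heS ((hmem (Sum.inr A.e)).1 h)
        · exact hvS
        · exact hbS _
        · exact hbS _
      · refine ⟨A.w₂, Sum.inl A.e, Sum.inl u, (hmem (Sum.inl u)).2 huS, Or.inr ⟨?_, ?_⟩⟩
        · refine IsBranch.fork (C := A.cover) (Sum.inl A.e) (Sum.inr false) (Sum.inr true) (Sum.inr ())
            A.newTgt_self hwe (fun h => by cases h) ?_ ?_ hw rfl rfl rfl
          · exact show A.newSrc (Sum.inr false) = some (Sum.inr ()) by simp [newSrc_false, hl]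
          · exact show A.newTgt (Sum.inr false) = none by simp [newTgt_false, hl]
        · exact A.newSrc_eq_some_inl.2 hu
      · rintro y hy ((v | v) | (a | c)) hz h
        · rcases hy with rfl | rfl | rfl | rfl
          · have hi : C.Incident A.e v := A.incident_inl.1 (EndGraph.adj_edge_vertex.1 h)
            rcases hi with hi | hi
            · rw [hu] at hi
              cases hi
              exact absurd ((hmem (Sum.inl u)).2 huS) hz
            · rw [A.tgt_e] at hi
              cases hi
          · exact absurd h EndGraph.not_adj_vertices
          · exact absurd (EndGraph.adj_edge_vertex.1 h) A.not_incident_inr_inl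
          · exact absurd (EndGraph.adj_edge_vertex.1 h) A.not_incident_inr_inl
        · exact Or.inr (Or.inl rfl)
        · rcases hy with rfl | rfl | rfl | rfl
          · exact absurd h EndGraph.not_adj_edges
          · obtain rfl := A.incident_inl_inr.1 (EndGraph.adj_vertex_edge.1 h)
            exact Or.inl rfl
          · exact absurd h EndGraph.not_adj_edges
          · exact absurd h EndGraph.not_adj_edges
        · cases c
          · exact Or.inr (Or.inr (Or.inl rfl))
          · exact Or.inr (Or.inr (Or.inr rfl))
    have old : ∀ x ∉ S, x ≠ Sum.inr A.e → ∃ K', A.cell x ∈ K' ∧ K' ⊆ (A.cell '' S)ᶜ ∧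
        A.cover.IsTail (A.cell '' S) K' ∧
        ∀ y ∈ K', ∀ z ∉ A.cell '' S, A.cover.cellGraph.Adj y z → z ∈ K' := by
      intro x hx hxe
      obtain ⟨K, hxK, hKS, hK, hcl⟩ := tails_iff.1 hS.tails x hx
      refine A.exists_tail_cell hmem hxK hKS hK hcl fun h => hxe ?_
      -- The only vertex of `A.e` lies in `S`, so `A.e` is isolated in the complement and a tail
      -- containing it has no other cell.
      have hr := hK.reachable hKS h hxK
      have := mem_of_reachable (K := {⟨Sum.inr A.e, heS⟩}) ?_ hr rfl
      · exact congrArg Subtype.val this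
      · rintro _ rfl ⟨z, hz⟩ hadj
        have hadj' : C.cellGraph.Adj (Sum.inr A.e) z := by simpa using hadj
        rcases z with v | a
        · rcases EndGraph.adj_edge_vertex.1 hadj' with hi | hi
          · rw [hu] at hi
            cases hi
            exact absurd huS hz
          · rw [A.tgt_e] at hi
            cases hi
        · exact absurd hadj' EndGraph.not_adj_edges
    rintro ((v | v) | (a | c)) hx
    · exact old (Sum.inl v) (fun h => hx ((hmem _).2 h)) (by simp)
    · exact new _ (Or.inr (Or.inl rfl))
    · by_cases ha : a = A.e
      · subst ha
        exact new _ (Or.inl rfl)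
      · exact old (Sum.inr a) (fun h => hx ((hmem _).2 h)) (by simpa using ha)
    · cases c
      · exact new _ (Or.inr (Or.inr (Or.inl rfl)))
      · exact new _ (Or.inr (Or.inr (Or.inr rfl)))

end Attachment

/-! ### Reflection of the line -/

/-- The composition of a cover with an order reversing map of its branch points. -/
noncomputable def reflect (C : TropicalCover) (f : ℝ → ℝ) (hf : StrictAntiOn f (Set.range C.pos)) :
    TropicalCover :=
  ofGraph ⟨C.V, C.E, C.tgt, C.src⟩ (fun v => f (C.pos v)) C.weight
    (by
      refine connected_of_hom (G := C.cellGraph) ⟨id, ?_⟩ C.connected fun b => ⟨b, .refl _⟩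
      intro a b h
      rw [EndGraph.cellGraph_adj] at h ⊢
      obtain ⟨v, e, h, hab⟩ := h
      exact ⟨v, e, h.symm, hab⟩)
    (fun v => (add_comm _ _).trans (C.valence_eq v))
    C.weight_pos
    (fun e u v hu hv => hf ⟨v, rfl⟩ ⟨u, rfl⟩ (pos_lt_pos hv hu))
    (fun v => (C.balanced v).symm)

variable {f : ℝ → ℝ} {hf : StrictAntiOn f (Set.range C.pos)}

theorem reflect_incident {e : C.E} {v : C.V} :
    (C.reflect f hf).Incident e v ↔ C.Incident e v := or_comm

theorem reflect_adj {a b : C.V ⊕ C.E} :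
    (C.reflect f hf).cellGraph.Adj a b ↔ C.cellGraph.Adj a b := by
  constructor
  · intro h
    obtain ⟨v, e, h, hab⟩ := EndGraph.cellGraph_adj.1 h
    exact EndGraph.cellGraph_adj.2 ⟨v, e, reflect_incident.1 h, hab⟩
  · intro h
    obtain ⟨v, e, h, hab⟩ := EndGraph.cellGraph_adj.1 h
    exact EndGraph.cellGraph_adj.2 ⟨v, e, (reflect_incident (hf := hf)).2 h, hab⟩

theorem reflect_isSymPair {a b : C.E} : (C.reflect f hf).IsSymPair a b ↔ C.IsSymPair a b := by
  constructor
  · rintro ⟨h1, h2, h3, h4, h5⟩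
    exact ⟨h1, h2, h4, h3, h5.symm⟩
  · rintro ⟨h1, h2, h3, h4, h5⟩
    exact ⟨h1, h2, h4, h3, h5.symm⟩

theorem IsBranch.reflect {far near : C.E → Option C.V} {k : ℕ} {e : C.E} {K : Set (C.V ⊕ C.E)}
    (h : C.IsBranch far near k e K) : (C.reflect f hf).IsBranch far near k e K := by
  have := IsBranch.map (C := C) (D := C.reflect f hf) (far' := far) (near' := near) id id
    Function.injective_id (fun a => rfl) h (fun a _ => (Option.map_id_apply ..).symm)
    (fun a _ => (Option.map_id_apply ..).symm)
  have hK : Sum.map id id '' K = K := by rw [Sum.map_id_id, Set.image_id]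
  exact (congrArg (IsBranch (C.reflect f hf) far near k e) hK).mp this

theorem IsTail.reflect {S K : Set (C.V ⊕ C.E)} (h : C.IsTail S K) :
    (C.reflect f hf).IsTail S K := by
  obtain ⟨k, e, v, hv, ⟨hb, he⟩ | ⟨hb, he⟩⟩ := h
  · exact ⟨k, e, v, hv, Or.inr ⟨hb.reflect, he⟩⟩
  · exact ⟨k, e, v, hv, Or.inl ⟨hb.reflect, he⟩⟩

theorem IsZigzagFor.reflect {S : Set (C.V ⊕ C.E)} (hS : C.IsZigzagFor S) :
    (C.reflect f hf).IsZigzagFor S := by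
  refine ⟨?_, ?_, hS.exists_vertex, ?_, hS.odd_edges, ?_⟩
  · exact fun e v he hi => hS.subgraph e v he (reflect_incident.1 hi)
  · refine connected_of_hom (G := C.cellGraph.induce S) ⟨id, ?_⟩ hS.connected fun b => ⟨b, .refl _⟩
    intro a b h
    exact SimpleGraph.comap_adj.2 (reflect_adj.2 (SimpleGraph.comap_adj.1 h))
  · refine sym_disjoint_iff.2 ?_
    intro a b hab
    have := sym_disjoint_iff.1 hS.disjoint_sym a b (reflect_isSymPair.1 hab)
    exact ⟨this.1, fun v hv => this.2 v (reflect_incident.1 hv)⟩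
  · refine tails_iff.2 ?_
    intro x hx
    obtain ⟨K, hxK, hKS, hK, hcl⟩ := tails_iff.1 hS.tails x hx
    exact ⟨K, hxK, hKS, hK.reflect, fun y hy z hz h => hcl y hy z hz (reflect_adj.1 h)⟩

theorem IsOfType.reflect {g : ℕ} {L M : Multiset ℕ} {z : Finset ℝ} (h : C.IsOfType g L M z) :
    (C.reflect f hf).IsOfType g M L (z.image f) := by
  refine ⟨?_, ?_, h.right_ends, h.left_ends⟩
  · rw [← h.genus_eq]
    unfold EndGraph.genus EndGraph.numLeaves
    rw [add_comm (Nat.card {e : C.E // C.src e = none})]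
    rfl
  · rw [Finset.coe_image, ← h.range_pos, ← Set.range_comp]
    rfl

theorem Iso.of_reflect {hf' : StrictAntiOn f (Set.range D.pos)}
    (hfz : Set.InjOn f (Set.range C.pos ∪ Set.range D.pos))
    (Φ : Iso (C.reflect f hf) (D.reflect f hf')) : Nonempty (Iso C D) :=
  ⟨Iso.ofData Φ.onV Φ.onE Φ.tgt_eq Φ.src_eq
    (fun v => hfz (Or.inr ⟨_, rfl⟩) (Or.inl ⟨_, rfl⟩) (Φ.pos_eq v)) Φ.weight_eq⟩

theorem Iso.incident (Φ : Iso C D) {e : C.E} {v : C.V} (h : C.Incident e v) :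
    D.Incident (Φ.onE e) (Φ.onV v) := by
  rcases h with h | h
  · left; rw [Φ.src_eq, h]; rfl
  · right; rw [Φ.tgt_eq, h]; rfl

/-- The attachment can be undone intrinsically: the new vertex is the one over `A.x`, the new ends
are the edges without an old vertex, and `A.e` is the old edge ending at the new vertex. An
isomorphism respects these descriptions and restricts to the original covers. -/
theorem Attachment.iso_of_iso (A : C.Attachment) (B : D.Attachment) (hx : A.x = B.x)
    (Φ : Iso A.cover B.cover) : Nonempty (Iso C D) := by
  let ΦV : C.V ⊕ Unit ≃ D.V ⊕ Unit := Φ.onV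
  let ΦE : C.E ⊕ Bool ≃ D.E ⊕ Bool := Φ.onE
  have hsrc : ∀ a, B.newSrc (ΦE a) = (A.newSrc a).map ΦV := Φ.src_eq
  have htgt : ∀ a, B.newTgt (ΦE a) = (A.newTgt a).map ΦV := Φ.tgt_eq
  have hpos : ∀ v, B.newPos (ΦV v) = A.newPos v := Φ.pos_eq
  have hw : ∀ a, B.newWeight (ΦE a) = A.newWeight a := Φ.weight_eq
  have hinc : ∀ {a v}, A.graph.Incident a v → B.graph.Incident (ΦE a) (ΦV v) := Φ.incident
  have hnew : ΦV (Sum.inr ()) = Sum.inr () := by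
    have h := hpos (Sum.inr ())
    cases hv : ΦV (Sum.inr ()) with
    | inl v =>
      rw [hv] at h
      have h1 := B.pos_lt v
      have h2 : D.pos v = A.x := h
      linarith
    | inr v => rfl
  have hV : ∀ v, ∃ v', ΦV (Sum.inl v) = Sum.inl v' := by
    intro v
    cases hv : ΦV (Sum.inl v) with
    | inl v' => exact ⟨v', rfl⟩
    | inr v' => exact absurd (ΦV.injective (hv.trans hnew.symm)) (by simp)
  choose φ hφ using hV
  -- By connectedness every old edge meets an old vertex, and no new edge does.
  have hE : ∀ a, ∃ a', ΦE (Sum.inl a) = Sum.inl a' := by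
    intro a
    obtain ⟨v, -⟩ := Option.ne_none_iff_exists'.1 A.src_e
    obtain ⟨u, hu⟩ := exists_incident v a
    have h := hinc (A.incident_inl.2 hu)
    cases ha : ΦE (Sum.inl a) with
    | inl a' => exact ⟨a', rfl⟩
    | inr b =>
      rw [ha, hφ] at h
      exact absurd h B.not_incident_inr_inl
  choose ψ hψ using hE
  have hφi : Function.Injective φ := fun u v h =>
    Sum.inl_injective (ΦV.injective ((hφ u).trans ((congrArg _ h).trans (hφ v).symm)))
  have hψi : Function.Injective ψ := fun u v h =>
    Sum.inl_injective (ΦE.injective ((hψ u).trans ((congrArg _ h).trans (hψ v).symm)))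
  have hφb : Function.Bijective φ := by
    rw [Fintype.bijective_iff_injective_and_card]
    exact ⟨hφi, by simpa using Fintype.card_congr ΦV⟩
  have hψb : Function.Bijective ψ := by
    rw [Fintype.bijective_iff_injective_and_card]
    exact ⟨hψi, by simpa using Fintype.card_congr ΦE⟩
  refine ⟨Iso.ofData (Equiv.ofBijective φ hφb) (Equiv.ofBijective ψ hψb) ?_ ?_ ?_ ?_⟩
  · intro a
    have h := hsrc (Sum.inl a)
    rw [hψ, Attachment.newSrc_inl, Attachment.newSrc_inl] at h
    apply Option.map_injective Sum.inl_injective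
    refine h.trans ?_
    cases C.src a with
    | none => rfl
    | some u => exact congrArg some (hφ u)
  · intro a
    have h := htgt (Sum.inl a)
    rw [hψ] at h
    by_cases ha : a = A.e
    · subst ha
      rw [A.newTgt_self, Option.map_some, hnew] at h
      have hb := B.newTgt_eq_some_inr.1 h
      rw [A.tgt_e]
      exact (congrArg D.tgt hb).trans B.tgt_e
    · have hb : ψ a ≠ B.e := by
        intro hb
        rw [hb, B.newTgt_self, ← hnew, ← Option.map_some] at h
        exact ha (A.newTgt_eq_some_inr.1 (Option.map_injective ΦV.injective h).symm)
      rw [A.newTgt_of_ne ha, B.newTgt_of_ne hb] at h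
      apply Option.map_injective Sum.inl_injective
      refine h.trans ?_
      cases C.tgt a with
      | none => rfl
      | some u => exact congrArg some (hφ u)
  · intro v
    have h := hpos (Sum.inl v)
    rw [hφ] at h
    exact h
  · intro a
    have h := hw (Sum.inl a)
    rw [hψ] at h
    exact h

/-! ### Injections between isomorphism classes -/

/-- Isomorphism classes of covers in `A` can be mapped injectively to those of covers in `B`. -/
def Dominated (A B : TropicalCover → Prop) : Prop :=
  ∃ f : TropicalCover → TropicalCover, (∀ C, A C → B (f C)) ∧
    ∀ C D, A C → A D → Nonempty (Iso (f C) (f D)) → Nonempty (Iso C D)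

theorem Dominated.trans {P Q R : TropicalCover → Prop} (h : Dominated P Q) (h' : Dominated Q R) :
    Dominated P R := by
  obtain ⟨f, hf, hf'⟩ := h
  obtain ⟨f', hg, hg'⟩ := h'
  exact ⟨fun C => f' (f C), fun C hC => hg _ (hf _ hC), fun C D hC hD h =>
    hf' _ _ hC hD (hg' _ _ (hf _ hC) (hf _ hD) h)⟩

theorem Dominated.of_imp {P Q : TropicalCover → Prop} (h : ∀ C, P C → Q C) : Dominated P Q :=
  ⟨id, h, fun _ _ _ _ h => h⟩

/-- The constructions depend on choices, such as the end of `S` that is prolonged. It suffices that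
the input can be recovered from the output whatever was chosen. -/
theorem Dominated.of_rel {P Q : TropicalCover → Prop} (R : TropicalCover → TropicalCover → Prop)
    (h : ∀ C, P C → ∃ C', Q C' ∧ R C C')
    (hR : ∀ C D C' D', R C C' → R D D' → Nonempty (Iso C' D') → Nonempty (Iso C D)) :
    Dominated P Q := by
  classical
  choose f hf using h
  refine ⟨fun C => if hC : P C then f C hC else C, fun C hC => ?_, fun C D hC hD h => ?_⟩
  · simp only [dif_pos hC]
    exact (hf C hC).1
  · simp only [dif_pos hC, dif_pos hD] at h
    exact hR _ _ _ _ (hf C hC).2 (hf D hD).2 h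

/-- The end of an edge on the right (`true`) or on the left (`false`). -/
def side (C : TropicalCover) : Bool → C.E → Option C.V
  | true => C.tgt
  | false => C.src

theorem reflect_side (σ : Bool) (e : C.E) : (C.reflect f hf).side σ e = C.side (!σ) e := by
  cases σ <;> rfl

/-- There is an end of weight `w` on the side `σ` in the subgraph `S`. -/
def EndIn (C : TropicalCover) (S : Set (C.V ⊕ C.E)) (p : Bool × ℕ) : Prop :=
  ∃ e, Sum.inr e ∈ S ∧ C.side p.1 e = none ∧ C.weight e = p.2

/-- There is an end of weight `w` on the side `σ` attached to a vertex of the subgraph `S`. -/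
def EndAt (C : TropicalCover) (S : Set (C.V ⊕ C.E)) (p : Bool × ℕ) : Prop :=
  ∃ e v, C.side p.1 e = none ∧ C.side (!p.1) e = some v ∧ Sum.inl v ∈ S ∧ C.weight e = p.2

/-- Generalized zigzag covers of a given type with prescribed ends in, respectively next to, the
odd subgraph. -/
def Good (g : ℕ) (L M : Multiset ℕ) (ins ats : List (Bool × ℕ)) (z : Finset ℝ)
    (C : TropicalCover) : Prop :=
  C.IsOfType g L M z ∧ ∃ S, C.IsZigzagFor S ∧ (∀ p ∈ ins, C.EndIn S p) ∧ ∀ p ∈ ats, C.EndAt S p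

def flip (p : Bool × ℕ) : Bool × ℕ := (!p.1, p.2)

theorem flip_flip : flip ∘ flip = id := by
  funext p
  simp [flip]

theorem exists_strictAntiOn_image {z z' : Finset ℝ} (h : z.card = z'.card) :
    ∃ f : ℝ → ℝ, StrictAntiOn f z ∧ z.image f = z' := by
  classical
  let a := z.orderIsoOfFin rfl
  let b := z'.orderIsoOfFin h.symm
  -- The points of `z` and `z'` are matched in opposite order; the value `0` off `z` plays no role.
  have hanti : StrictAntiOn (fun x => if hx : x ∈ z then ((b (a.symm ⟨x, hx⟩).rev : z') : ℝ) else 0)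
      z := by
    intro x hx y hy hxy
    have hx' : x ∈ z := hx
    have hy' : y ∈ z := hy
    simp only [dif_pos hx', dif_pos hy']
    have : (⟨x, hx'⟩ : z) < ⟨y, hy'⟩ := hxy
    exact b.strictMono (Fin.rev_lt_rev.2 (a.symm.strictMono this))
  refine ⟨_, hanti, ?_⟩
  apply Finset.eq_of_subset_of_card_le
  · intro y hy
    obtain ⟨x, hx, rfl⟩ := Finset.mem_image.1 hy
    simp only [dif_pos hx]
    exact Subtype.prop _
  · rw [Finset.card_image_of_injOn hanti.injOn, h]

theorem dominated_reflect (g : ℕ) (L M : Multiset ℕ) (ins ats : List (Bool × ℕ)) {z z' : Finset ℝ}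
    (h : z.card = z'.card) :
    Dominated (Good g L M ins ats z) (Good g M L (ins.map flip) (ats.map flip) z') := by
  obtain ⟨f, hf, hz⟩ := exists_strictAntiOn_image h
  -- The relation records the branch points because `f` is injective only on `z`, which is needed to
  -- undo the reflection.
  refine Dominated.of_rel (fun C C' => Set.range C.pos = z ∧
    ∃ hC : StrictAntiOn f (Set.range C.pos), C' = C.reflect f hC) ?_ ?_
  · rintro C ⟨ht, S, hS, hins, hats⟩
    have hC : StrictAntiOn f (Set.range C.pos) := by rwa [ht.range_pos]
    refine ⟨C.reflect f hC, ⟨hz ▸ ht.reflect, S, hS.reflect, ?_, ?_⟩, ht.range_pos, hC, rfl⟩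
    · rintro _ hp'
      obtain ⟨p, hp, rfl⟩ := List.mem_map.1 hp'
      obtain ⟨e, he, h1, h2⟩ := hins p hp
      exact ⟨e, he, (reflect_side _ e).trans (by rwa [flip, Bool.not_not]), h2⟩
    · rintro _ hp'
      obtain ⟨p, hp, rfl⟩ := List.mem_map.1 hp'
      obtain ⟨e, v, h1, h2, hv, h3⟩ := hats p hp
      exact ⟨e, v, (reflect_side _ e).trans (by rwa [flip, Bool.not_not]),
        (reflect_side _ e).trans (by rwa [flip, Bool.not_not]), hv, h3⟩
  · rintro C D _ _ ⟨h1, hC, rfl⟩ ⟨h2, hD, rfl⟩ ⟨Φ⟩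
    refine Iso.of_reflect ?_ Φ
    rw [h1, h2, Set.union_self]
    exact hf.injOn

/-- Two reflections compose to an increasing change of branch points, so only the number of points
matters. -/
theorem dominated_reposition (g : ℕ) (L M : Multiset ℕ) (ins ats : List (Bool × ℕ))
    {z z' : Finset ℝ} (h : z.card = z'.card) :
    Dominated (Good g L M ins ats z) (Good g L M ins ats z') := by
  have := (dominated_reflect g L M ins ats (rfl : z.card = z.card)).trans
    (dominated_reflect g M L _ _ h)
  simpa [flip_flip] using this

/-! ### Elementary moves to the right of all branch points -/

/-- The set `{0, …, r - 1}` of branch points. -/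
noncomputable def firstPoints (r : ℕ) : Finset ℝ := (Finset.range r).image Nat.cast

theorem card_firstPoints (r : ℕ) : (firstPoints r).card = r := by
  rw [firstPoints, Finset.card_image_of_injective _ Nat.cast_injective, Finset.card_range]

theorem firstPoints_succ (r : ℕ) : firstPoints (r + 1) = insert (r : ℝ) (firstPoints r) := by
  rw [firstPoints, Finset.range_add_one, Finset.image_insert, firstPoints]

theorem IsOfType.pos_lt {g : ℕ} {L M : Multiset ℕ} {r : ℕ} (h : C.IsOfType g L M (firstPoints r))
    (v : C.V) : C.pos v < r := by
  have hv : C.pos v ∈ Set.range C.pos := ⟨v, rfl⟩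
  rw [h.range_pos, Finset.mem_coe, firstPoints, Finset.mem_image] at hv
  obtain ⟨i, hi, hiv⟩ := hv
  rw [← hiv]
  exact_mod_cast Finset.mem_range.1 hi

theorem side_not_ne_none (v : C.V) {σ : Bool} {e : C.E} (h : C.side σ e = none) :
    C.side (!σ) e ≠ none := by
  obtain ⟨u, hu | hu⟩ := exists_incident v e <;> cases σ <;> simp_all [side]

/-- Using one `x` for all covers makes the attached vertex recognizable, whichever end it is
attached to. -/
theorem Dominated.of_attach {P Q : TropicalCover → Prop} (x : ℝ)
    (h : ∀ C, P C → ∃ A : C.Attachment, A.x = x ∧ Q A.cover) : Dominated P Q := by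
  refine Dominated.of_rel (fun C C' => ∃ A : C.Attachment, A.x = x ∧ C' = A.cover) ?_ ?_
  · intro C hC
    obtain ⟨A, hx, hQ⟩ := h C hC
    exact ⟨A.cover, hQ, A, hx, rfl⟩
  · rintro C D _ _ ⟨A, hA, rfl⟩ ⟨B, hB, rfl⟩ ⟨Φ⟩
    exact A.iso_of_iso B (hA.trans hB.symm) Φ

theorem Attachment.side_inl_eq_none (A : C.Attachment) {σ : Bool} {a : C.E} (ha : a ≠ A.e)
    (h : C.side σ a = none) : A.cover.side σ (Sum.inl a) = none := by
  cases σ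
  · exact A.newSrc_eq_none.2 h
  · exact A.newTgt_eq_none.2 ⟨ha, h⟩

theorem Good.mono {g : ℕ} {L M : Multiset ℕ} {ins ats ins' ats' : List (Bool × ℕ)} {z : Finset ℝ}
    (h : Good g L M ins ats z C) (hi : ins' ⊆ ins) (ha : ats' ⊆ ats) :
    Good g L M ins' ats' z C := by
  obtain ⟨ht, S, hS, h1, h2⟩ := h
  exact ⟨ht, S, hS, fun p hp => h1 p (hi hp), fun p hp => h2 p (ha hp)⟩

theorem dominated_mono {g : ℕ} {L M : Multiset ℕ} {ins ats ins' ats' : List (Bool × ℕ)}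
    {z : Finset ℝ} (hi : ins' ⊆ ins) (ha : ats' ⊆ ats) :
    Dominated (Good g L M ins ats z) (Good g L M ins' ats' z) :=
  Dominated.of_imp fun _ h => h.mono hi ha

/-- A prescribed right end might be `A.e`, which stops being an end; a left end cannot be. Hence the
moves only keep track of further ends on the left. -/
theorem Attachment.endIn_extend (A : C.Attachment) {S : Set (C.V ⊕ C.E)} {b : Bool} {p : Bool × ℕ}
    (hp : p.1 = false) (h : C.EndIn S p) : A.cover.EndIn (A.extend S b) p := by
  obtain ⟨f, hf, h1, h2⟩ := h
  refine ⟨Sum.inl f, A.cell_mem_extend.2 hf, A.side_inl_eq_none ?_ h1, h2⟩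
  rintro rfl
  rw [hp] at h1
  exact A.src_e h1

/-- A left end of even weight can be joined to a right end of the odd subgraph. -/
theorem dominated_joinEnd (g : ℕ) (L M : Multiset ℕ) (b : ℕ) {k : ℕ} (hk : 0 < k)
    {ins : List (Bool × ℕ)} (hins : ∀ p ∈ ins, p.1 = false) (r : ℕ) :
    Dominated (Good g L (b ::ₘ M) ((true, b) :: ins) [] (firstPoints r))
      (Good g ((2 * k) ::ₘ L) ((b + 2 * k) ::ₘ M) ((true, b + 2 * k) :: ins) [(false, 2 * k)]
        (firstPoints (r + 1))) := by
  refine Dominated.of_attach r ?_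
  rintro C ⟨ht, S, hS, hi, -⟩
  obtain ⟨e, heS, he, rfl⟩ := hi _ List.mem_cons_self
  obtain ⟨u, hu⟩ := hS.exists_vertex
  let A : C.Attachment :=
    { e := e
      left := true
      w₁ := 2 * k
      w₂ := C.weight e + 2 * k
      x := r
      tgt_e := he
      src_e := side_not_ne_none u he
      pos_lt := ht.pos_lt
      w₁_pos := by omega
      w₂_pos := by omega
      balance := by simp }
  refine ⟨A, rfl, ?_, A.extend S true, ?_, ?_, ?_⟩
  · rw [firstPoints_succ]
    exact A.isOfType ht
  · exact A.isZigzagFor_extend hS heS true ((hS.odd_edges e heS).add_even (even_two_mul k))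
      (even_two_mul k)
  · rintro p hp
    rcases List.mem_cons.1 hp with rfl | hp
    · exact ⟨Sum.inr true, A.new_edge_mem_extend.2 rfl, rfl, rfl⟩
    · exact A.endIn_extend (hins p hp) (hi p (List.mem_cons_of_mem _ hp))
  · intro p hp
    obtain rfl := List.mem_singleton.1 hp
    exact ⟨Sum.inr false, Sum.inr (), rfl, rfl, A.new_vertex_mem_extend S true, rfl⟩

/-- A right end of even weight can be split off from a right end of the odd subgraph. -/
theorem dominated_splitEnd (g : ℕ) (L M : Multiset ℕ) {b k : ℕ} (hb : 0 < b) (hk : 0 < k)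
    {ins : List (Bool × ℕ)} (hins : ∀ p ∈ ins, p.1 = false) (r : ℕ) :
    Dominated (Good g L ((b + 2 * k) ::ₘ M) ((true, b + 2 * k) :: ins) [] (firstPoints r))
      (Good g L ((2 * k) ::ₘ b ::ₘ M) ((true, b) :: ins) [(true, 2 * k)]
        (firstPoints (r + 1))) := by
  refine Dominated.of_attach r ?_
  rintro C ⟨ht, S, hS, hi, -⟩
  obtain ⟨e, heS, he, hw⟩ := hi _ List.mem_cons_self
  replace hw : C.weight e = b + 2 * k := hw
  obtain ⟨u, hu⟩ := hS.exists_vertex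
  let A : C.Attachment :=
    { e := e
      left := false
      w₁ := 2 * k
      w₂ := b
      x := r
      tgt_e := he
      src_e := side_not_ne_none u he
      pos_lt := ht.pos_lt
      w₁_pos := by omega
      w₂_pos := hb
      balance := by simpa using hw }
  have hodd : Odd b := by
    have := hS.odd_edges e heS
    rw [hw, Nat.odd_add] at this
    exact this.2 (even_two_mul k)
  refine ⟨A, rfl, ?_, A.extend S true, ?_, ?_, ?_⟩
  · rw [firstPoints_succ]
    rw [← hw] at ht
    exact A.isOfType ht
  · exact A.isZigzagFor_extend hS heS true hodd (even_two_mul k)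
  · rintro p hp
    rcases List.mem_cons.1 hp with rfl | hp
    · exact ⟨Sum.inr true, A.new_edge_mem_extend.2 rfl, rfl, rfl⟩
    · exact A.endIn_extend (hins p hp) (hi p (List.mem_cons_of_mem _ hp))
  · intro p hp
    obtain rfl := List.mem_singleton.1 hp
    exact ⟨Sum.inr false, Sum.inr (), rfl, rfl, A.new_vertex_mem_extend S true, rfl⟩

/-- A right end of the odd subgraph can be joined with a left end, such that the odd subgraph
continues to the left. -/
theorem dominated_turnEnd (g : ℕ) (L M : Multiset ℕ) {b c k : ℕ} (hc : 0 < c)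
    (hbc : b + c = 2 * k) {ins : List (Bool × ℕ)} (hins : ∀ p ∈ ins, p.1 = false) (r : ℕ) :
    Dominated (Good g L (b ::ₘ M) ((true, b) :: ins) [] (firstPoints r))
      (Good g (c ::ₘ L) ((2 * k) ::ₘ M) ((false, c) :: ins) [(true, 2 * k)]
        (firstPoints (r + 1))) := by
  refine Dominated.of_attach r ?_
  rintro C ⟨ht, S, hS, hi, -⟩
  obtain ⟨e, heS, he, rfl⟩ := hi _ List.mem_cons_self
  obtain ⟨u, hu⟩ := hS.exists_vertex
  let A : C.Attachment :=
    { e := e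
      left := true
      w₁ := c
      w₂ := 2 * k
      x := r
      tgt_e := he
      src_e := side_not_ne_none u he
      pos_lt := ht.pos_lt
      w₁_pos := hc
      w₂_pos := by omega
      balance := by simpa using hbc }
  -- The end of `S` is odd and the outgoing weight is even, so the new left end is odd and can carry
  -- the continuation of `S`.
  have hodd : Odd c := by
    have h1 := hS.odd_edges e heS
    have h2 : Even (C.weight e + c) := hbc ▸ even_two_mul k
    rw [Nat.even_add'] at h2
    exact h2.1 h1
  refine ⟨A, rfl, ?_, A.extend S false, ?_, ?_, ?_⟩
  · rw [firstPoints_succ]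
    exact A.isOfType ht
  · exact A.isZigzagFor_extend hS heS false hodd (even_two_mul k)
  · rintro p hp
    rcases List.mem_cons.1 hp with rfl | hp
    · exact ⟨Sum.inr false, A.new_edge_mem_extend.2 rfl, rfl, rfl⟩
    · exact A.endIn_extend (hins p hp) (hi p (List.mem_cons_of_mem _ hp))
  · intro p hp
    obtain rfl := List.mem_singleton.1 hp
    exact ⟨Sum.inr true, Sum.inr (), rfl, rfl, A.new_vertex_mem_extend S false, rfl⟩

/-- An even right end next to the odd subgraph can be split into a symmetric fork. -/
theorem dominated_fork (g : ℕ) (L M : Multiset ℕ) {k : ℕ} (hk : 0 < k) (ins : List (Bool × ℕ))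
    (r : ℕ) :
    Dominated (Good g L ((2 * k) ::ₘ M) ins [(true, 2 * k)] (firstPoints r))
      (Good g L (k ::ₘ k ::ₘ M) ins [] (firstPoints (r + 1))) := by
  refine Dominated.of_attach r ?_
  rintro C ⟨ht, S, hS, hi, ha⟩
  obtain ⟨e, u, he, hu, huS, hw⟩ := ha _ List.mem_cons_self
  replace hw : C.weight e = 2 * k := hw
  let A : C.Attachment :=
    { e := e
      left := false
      w₁ := k
      w₂ := k
      x := r
      tgt_e := he
      src_e := side_not_ne_none u he
      pos_lt := ht.pos_lt
      w₁_pos := hk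
      w₂_pos := hk
      balance := by simp [hw, two_mul] }
  refine ⟨A, rfl, ?_, A.cell '' S, ?_, ?_, by simp⟩
  · rw [firstPoints_succ]
    rw [← hw] at ht
    exact A.isOfType ht
  · exact A.isZigzagFor_fork hS hu huS rfl rfl
  · intro p hp
    obtain ⟨f, hf, h1, h2⟩ := hi p hp
    refine ⟨Sum.inl f, ⟨_, hf, rfl⟩, A.side_inl_eq_none ?_ h1, h2⟩
    intro hfe
    -- Edges of `S` are odd and the split end is even, so no prescribed end of `S` is destroyed.
    have h3 : Odd (C.weight f) := hS.odd_edges _ hf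
    rw [show f = e from hfe, hw] at h3
    exact Nat.not_even_iff_odd.2 h3 (even_two_mul k)

theorem dominated_fork_left (g : ℕ) (L M : Multiset ℕ) {k : ℕ} (hk : 0 < k)
    (ins : List (Bool × ℕ)) (r : ℕ) :
    Dominated (Good g ((2 * k) ::ₘ L) M ins [(false, 2 * k)] (firstPoints r))
      (Good g (k ::ₘ k ::ₘ L) M ins [] (firstPoints (r + 1))) := by
  have := ((dominated_reflect g ((2 * k) ::ₘ L) M ins [(false, 2 * k)] rfl).trans
    (dominated_fork g M L hk (ins.map flip) r)).trans (dominated_reflect g _ _ _ _ rfl)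
  simpa [flip_flip] using this

/-! ### Attaching several tails -/

/-- The multisets of weights of the ends of tails without symmetric cycles. -/
inductive IsTailWeights : Multiset ℕ → Prop
  | zero : IsTailWeights 0
  | leaf (k : ℕ) (T : Multiset ℕ) : 0 < k → IsTailWeights T → IsTailWeights ((2 * k) ::ₘ T)
  | fork (k : ℕ) (T : Multiset ℕ) : 0 < k → IsTailWeights T → IsTailWeights (k ::ₘ k ::ₘ T)

/-- A leaf costs one new vertex and a fork two, that is, one vertex per part of `T`; the end of `S`
absorbs the weights of all tails. -/
theorem dominated_join (g : ℕ) {T : Multiset ℕ} (hT : IsTailWeights T)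
    {ins : List (Bool × ℕ)} (hins : ∀ p ∈ ins, p.1 = false) :
    ∀ (L M : Multiset ℕ) (b r : ℕ),
    Dominated (Good g L (b ::ₘ M) ((true, b) :: ins) [] (firstPoints r))
      (Good g (T + L) ((b + T.sum) ::ₘ M) ((true, b + T.sum) :: ins) []
        (firstPoints (r + T.card))) := by
  induction hT with
  | zero =>
    intro L M b r
    simpa using Dominated.of_imp fun _ h => h
  | leaf k T hk hT ih =>
    intro L M b r
    have := ((dominated_joinEnd g L M b hk hins r).trans
      (dominated_mono (fun _ h => h) (List.nil_subset _))).trans (ih ((2 * k) ::ₘ L) M _ _)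
    rw [Multiset.sum_cons, Multiset.card_cons, Multiset.cons_add, ← Multiset.add_cons,
      ← add_assoc b, add_comm T.card, ← add_assoc r]
    exact this
  | fork k T hk hT ih =>
    intro L M b r
    have := ((dominated_joinEnd g L M b hk hins r).trans
      (dominated_fork_left g _ _ hk _ _)).trans (ih (k ::ₘ k ::ₘ L) M _ _)
    rw [Multiset.sum_cons, Multiset.sum_cons, Multiset.card_cons, Multiset.card_cons,
      Multiset.cons_add, Multiset.cons_add, ← Multiset.add_cons, ← Multiset.add_cons,
      show b + (k + (k + T.sum)) = b + 2 * k + T.sum by ring,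
      show r + (T.card + 1 + 1) = r + 1 + 1 + T.card by ring]
    exact this

/-- The end of `S` sheds the tails one by one. The condition `0 < b` keeps a genuine end after the
last of them. -/
theorem dominated_split (g : ℕ) {T : Multiset ℕ} (hT : IsTailWeights T)
    {ins : List (Bool × ℕ)} (hins : ∀ p ∈ ins, p.1 = false) :
    ∀ (L M : Multiset ℕ) (b r : ℕ), 0 < b →
    Dominated (Good g L ((b + T.sum) ::ₘ M) ((true, b + T.sum) :: ins) [] (firstPoints r))
      (Good g L (b ::ₘ (T + M)) ((true, b) :: ins) [] (firstPoints (r + T.card))) := by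
  induction hT with
  | zero =>
    intro L M b r _
    simpa using Dominated.of_imp fun _ h => h
  | leaf k T hk hT ih =>
    intro L M b r hb
    have h1 := (dominated_splitEnd g L M (b := b + T.sum) (by omega) hk hins r).trans
      (dominated_mono (fun _ h => h) (List.nil_subset _))
    rw [Multiset.cons_swap] at h1
    have := h1.trans (ih L ((2 * k) ::ₘ M) b _ hb)
    rw [Multiset.sum_cons, Multiset.card_cons, Multiset.cons_add, ← Multiset.add_cons,
      add_comm (2 * k), ← add_assoc b, add_comm T.card, ← add_assoc r]
    exact this
  | fork k T hk hT ih =>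
    intro L M b r hb
    have h1 := (dominated_splitEnd g L M (b := b + T.sum) (by omega) hk hins r).trans
      (dominated_fork g _ _ hk _ _)
    rw [Multiset.cons_swap k (b + T.sum), Multiset.cons_swap k (b + T.sum)] at h1
    have := h1.trans (ih L (k ::ₘ k ::ₘ M) b _ hb)
    rw [Multiset.sum_cons, Multiset.sum_cons, Multiset.card_cons, Multiset.card_cons,
      Multiset.cons_add, Multiset.cons_add, ← Multiset.add_cons, ← Multiset.add_cons,
      show b + (k + (k + T.sum)) = b + T.sum + 2 * k by ring,
      show r + (T.card + 1 + 1) = r + 1 + 1 + T.card by ring]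
    exact this

/-! ### Local structure of tails and the multiplicity -/

theorem incident_of_side {σ : Bool} {e : C.E} {v : C.V} (h : C.side σ e = some v) :
    C.Incident e v := by
  cases σ
  · exact Or.inl h
  · exact Or.inr h

theorem not_loop_side {σ : Bool} {e : C.E} {v : C.V} (h : C.side σ e = some v)
    (h' : C.side (!σ) e = some v) : False := by
  cases σ
  · exact not_loop h h'
  · exact not_loop h' h

theorem ne_of_side {σ : Bool} {e f : C.E} {v : C.V} (h : C.side σ e = some v)
    (h' : C.side (!σ) f = some v) : e ≠ f := by
  rintro rfl
  exact not_loop_side h h'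

theorem IsSymPair.side_eq {e f : C.E} (h : C.IsSymPair e f) (σ : Bool) :
    C.side σ e = C.side σ f := by
  cases σ
  · exact h.2.2.1
  · exact h.2.2.2.1

theorem isSymPair_of_side {σ : Bool} {e f : C.E} {v : C.V} (hne : e ≠ f)
    (hw : C.weight e = C.weight f) (h : C.side σ e = C.side σ f) (he : C.side (!σ) e = some v)
    (hf : C.side (!σ) f = some v) : C.IsSymPair e f := by
  cases σ
  · exact ⟨hne, hw, h, he.trans hf.symm, Or.inr fun h0 => by cases h0.symm.trans he⟩
  · exact ⟨hne, hw, he.trans hf.symm, h, Or.inl fun h0 => by cases h0.symm.trans he⟩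

theorem isTail_iff {S K : Set (C.V ⊕ C.E)} : C.IsTail S K ↔
    ∃ σ k e v, Sum.inl v ∈ S ∧ C.IsBranch (C.side σ) (C.side (!σ)) k e K ∧
      C.side (!σ) e = some v := by
  constructor
  · rintro ⟨k, e, v, hv, h | h⟩
    · exact ⟨false, k, e, v, hv, h⟩
    · exact ⟨true, k, e, v, hv, h⟩
  · rintro ⟨σ, k, e, v, hv, h⟩
    cases σ
    · exact ⟨k, e, v, hv, Or.inl h⟩
    · exact ⟨k, e, v, hv, Or.inr h⟩

/-- Every even inner edge of a tail is preceded by a symmetric cycle or fork. -/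
theorem IsBranch.exists_isSymPair {σ : Bool} {k : ℕ} {e : C.E} {K : Set (C.V ⊕ C.E)}
    (h : C.IsBranch (C.side σ) (C.side (!σ)) k e K) {a : C.E} (ha : Sum.inr a ∈ K)
    (heven : Even (C.weight a)) (hinner : C.side σ a ≠ none) :
    ∃ c c' w, C.IsSymPair c c' ∧ C.side (!σ) c = some w ∧ C.side σ a = some w := by
  induction h with
  | leaf e he hwe =>
    cases ha
    exact absurd he hinner
  | fork e f f' w he hwe hff hf1 hf2 hf3 hf1' hf2' hf3' =>
    rcases ha with ha | ha | ha | ha <;> cases ha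
    · exact ⟨f, f', w, isSymPair_of_side hff (hf3.trans hf3'.symm) (hf2.trans hf2'.symm) hf1 hf1',
        hf1, he⟩
    · exact absurd hf2 hinner
    · exact absurd hf2' hinner
  | cycle b c c' e u w K hk hb hbu hcc hc1 hc2 hc3 hc1' hc2' hc3' he hwe ih =>
    rcases ha with ha | ha | ha | ha | ha | ha
    · exact ih ha
    · cases ha
    · cases ha
      -- Symmetric cycles occur only for odd `k`, so their edges are odd.
      rw [hc3] at heven
      exact absurd heven (Nat.not_even_iff_odd.2 hk)
    · cases ha
      rw [hc3'] at heven
      exact absurd heven (Nat.not_even_iff_odd.2 hk)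
    · cases ha
    · cases ha
      exact ⟨c, c', w, isSymPair_of_side hcc (hc3.trans hc3'.symm) (hc1.trans hc1'.symm) hc2 hc2',
        hc2, he⟩

/-- Every symmetric cycle or fork of a tail is followed by an even edge. -/
theorem IsBranch.exists_even_edge {σ : Bool} {k : ℕ} {e : C.E} {K : Set (C.V ⊕ C.E)}
    (h : C.IsBranch (C.side σ) (C.side (!σ)) k e K) {a b : C.E} (ha : Sum.inr a ∈ K)
    (hab : C.IsSymPair a b) (hae : a ≠ e) :
    ∃ f w, Sum.inr f ∈ K ∧ Even (C.weight f) ∧ C.side σ f = some w ∧ C.side (!σ) a = some w ∧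
      (f = e ∨ C.side (!σ) f ≠ none) := by
  induction h with
  | leaf e he hwe =>
    cases ha
    exact absurd rfl hae
  | fork e f f' w he hwe hff hf1 hf2 hf3 hf1' hf2' hf3' =>
    have heven : Even (C.weight e) := hwe ▸ even_two_mul k
    rcases ha with ha | ha | ha | ha <;> cases ha
    · exact absurd rfl hae
    · exact ⟨e, w, Or.inl rfl, heven, he, hf1, Or.inl rfl⟩
    · exact ⟨e, w, Or.inl rfl, heven, he, hf1', Or.inl rfl⟩
  | cycle d c c' e u w K hk hd hdu hcc hc1 hc2 hc3 hc1' hc2' hc3' he hwe ih =>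
    have heven : Even (C.weight e) := hwe ▸ even_two_mul k
    rcases ha with ha | ha | ha | ha | ha | ha
    · by_cases had : a = d
      · subst had
        exfalso
        have hbu : C.side (!σ) b = some u := (hab.side_eq _).symm.trans hdu
        rcases eq_of_incident (incident_of_side hdu) (incident_of_side hc1)
          (incident_of_side hc1') (ne_of_side hc1 hdu).symm (ne_of_side hc1' hdu).symm hcc
          (incident_of_side hbu) with rfl | rfl | rfl
        · exact hab.1 rfl
        · exact not_loop_side hc1 hbu
        · exact not_loop_side hc1' hbu
      · obtain ⟨f, w, hf, h1, h2, h3, h4⟩ := ih ha had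
        refine ⟨f, w, Or.inl hf, h1, h2, h3, Or.inr ?_⟩
        rcases h4 with rfl | h4
        · rw [hdu]; simp
        · exact h4
    · cases ha
    · cases ha
      exact ⟨e, w, Or.inr (by simp), heven, he, hc2, Or.inl rfl⟩
    · cases ha
      exact ⟨e, w, Or.inr (by simp), heven, he, hc2', Or.inl rfl⟩
    · cases ha
    · cases ha
      exact absurd rfl hae

/-- Every odd end of a tail belongs to a symmetric fork. -/
theorem IsBranch.exists_isSymPair_of_end {σ : Bool} {k : ℕ} {e : C.E} {K : Set (C.V ⊕ C.E)}
    (h : C.IsBranch (C.side σ) (C.side (!σ)) k e K) {a : C.E} (ha : Sum.inr a ∈ K)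
    (hodd : Odd (C.weight a)) {τ : Bool} (hend : C.side τ a = none) :
    ∃ b, C.IsSymPair a b := by
  have hne : ∀ {x y}, C.side σ a = some x → C.side (!σ) a = some y → False := by
    intro x y hx hy
    cases σ <;> cases τ <;> simp_all [side]
  have hev : C.weight a ≠ 2 * k := fun h0 =>
    Nat.not_even_iff_odd.2 hodd (h0 ▸ even_two_mul k)
  induction h with
  | leaf e he hwe =>
    cases ha
    exact absurd hwe hev
  | fork e f f' w he hwe hff hf1 hf2 hf3 hf1' hf2' hf3' =>
    rcases ha with ha | ha | ha | ha <;> cases ha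
    · exact absurd hwe hev
    · exact ⟨f', isSymPair_of_side hff (hf3.trans hf3'.symm) (hf2.trans hf2'.symm) hf1 hf1'⟩
    · exact ⟨f, isSymPair_of_side hff.symm (hf3'.trans hf3.symm) (hf2'.trans hf2.symm) hf1' hf1⟩
  | cycle d c c' e u w K hk hd hdu hcc hc1 hc2 hc3 hc1' hc2' hc3' he hwe ih =>
    rcases ha with ha | ha | ha | ha | ha | ha
    · exact ih ha
    · cases ha
    · cases ha
      exact (hne hc1 hc2).elim
    · cases ha
      exact (hne hc1' hc2').elim
    · cases ha
    · cases ha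
      exact absurd hwe hev

/-- Even edges and symmetric pairs all lie outside `S`, hence in tails. Assigning to an even inner
edge the symmetric pair at its far endpoint is a bijection, because trivalence lets the edge and the
pair determine each other. -/
theorem IsZigzagFor.card_even_inner_edges {S : Set (C.V ⊕ C.E)} (hS : C.IsZigzagFor S) :
    Nat.card {e : C.E // C.IsInner e ∧ Even (C.weight e)} = C.sym.ncard := by
  choose δ k t v hv hK hnear using fun K => isTail_iff.1 (hS.tails K)
  have hdis := sym_disjoint_iff.1 hS.disjoint_sym
  let κ : (x : C.V ⊕ C.E) → x ∉ S → (C.cellGraph.induce Sᶜ).ConnectedComponent :=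
    fun x hx => (C.cellGraph.induce Sᶜ).connectedComponentMk ⟨x, hx⟩
  have hmem : ∀ {x} (hx : x ∉ S) (K), x ∈ Subtype.val '' K.supp ↔ κ x hx = K := by
    intro x hx K
    constructor
    · rintro ⟨y, hy, rfl⟩
      exact hy
    · intro h
      exact ⟨⟨x, hx⟩, h, rfl⟩
  have hκ : ∀ {a w} (ha : Sum.inr a ∉ S) (hw : Sum.inl w ∉ S), C.Incident a w →
      κ _ ha = κ _ hw := by
    intro a w ha hw h
    refine SimpleGraph.ConnectedComponent.eq.2 (SimpleGraph.Adj.reachable ?_)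
    exact SimpleGraph.comap_adj.2 (EndGraph.adj_edge_vertex.2 h)
  have heS : ∀ {a}, Even (C.weight a) → Sum.inr a ∉ S := fun h h' =>
    Nat.not_even_iff_odd.2 (hS.odd_edges _ h') h
  have hinner : ∀ {a} (σ : Bool), C.IsInner a → C.side σ a ≠ none := by
    rintro a (_ | _) h
    · exact h.1
    · exact h.2
  -- The pair `p` meets `a` at the endpoint `w` of `a` away from `S`; the direction `δ` is that of
  -- the tail containing `a`.
  let R : C.E → Sym2 C.E → Prop := fun a p => ∃ (ha : Sum.inr a ∉ S) (w : C.V),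
    C.side (δ (κ _ ha)) a = some w ∧ ∀ x ∈ p, C.side (!δ (κ _ ha)) x = some w
  have hex : ∀ a : {e : C.E // C.IsInner e ∧ Even (C.weight e)}, ∃ p : C.sym, R a p := by
    rintro ⟨a, hi, he⟩
    have ha := heS he
    obtain ⟨c, c', w, hc, h1, h2⟩ := (hK (κ _ ha)).exists_isSymPair ((hmem ha _).2 rfl) he
      (hinner _ hi)
    refine ⟨⟨s(c, c'), mem_sym hc⟩, ha, w, h2, ?_⟩
    intro x hx
    rcases Sym2.mem_iff.1 hx with rfl | rfl
    · exact h1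
    · exact (hc.side_eq _).symm.trans h1
  choose F hF using hex
  rw [← Nat.card_coe_set_eq]
  refine Nat.card_eq_of_bijective F ⟨?_, ?_⟩
  · rintro ⟨a, hi, he⟩ ⟨a', hi', he'⟩ heq
    obtain ⟨ha, w, hw, hp⟩ := hF ⟨a, hi, he⟩
    obtain ⟨ha', w', hw', hp'⟩ := hF ⟨a', hi', he'⟩
    rw [← heq] at hp'
    obtain ⟨c, c', hcc, hsym⟩ := (F ⟨a, hi, he⟩).2
    have hc : c ∈ (F ⟨a, hi, he⟩ : Sym2 C.E) := by rw [hcc]; simp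
    have hc' : c' ∈ (F ⟨a, hi, he⟩ : Sym2 C.E) := by rw [hcc]; simp
    obtain ⟨hcS, hcV⟩ := hdis c c' hsym
    have hwS := hcV w (incident_of_side (hp c hc))
    have hwS' := hcV w' (incident_of_side (hp' c hc))
    -- Both edges are connected through the common pair, so they lie in one tail and their
    -- directions agree.
    have hκκ : κ _ ha = κ _ ha' :=
      (hκ ha hwS (incident_of_side hw)).trans ((hκ hcS hwS (incident_of_side (hp c hc))).symm.trans
        ((hκ hcS hwS' (incident_of_side (hp' c hc))).trans
          (hκ ha' hwS' (incident_of_side hw')).symm))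
    replace hw' : C.side (δ (κ _ ha')) a' = some w' := hw'
    replace hp' : ∀ x ∈ (F ⟨a, hi, he⟩ : Sym2 C.E), C.side (!δ (κ _ ha')) x = some w' := hp'
    rw [← hκκ] at hw' hp'
    obtain rfl : w = w' := Option.some_injective _ ((hp c hc).symm.trans (hp' c hc))
    rcases eq_of_incident (incident_of_side hw) (incident_of_side (hp c hc))
      (incident_of_side (hp c' hc')) (ne_of_side hw (hp c hc)) (ne_of_side hw (hp c' hc')) hsym.1
      (incident_of_side hw') with h | h | h
    · exact Subtype.ext h.symm
    · exact absurd h (ne_of_side hw' (hp c hc))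
    · exact absurd h (ne_of_side hw' (hp c' hc'))
  · rintro ⟨p, c, c', rfl, hsym⟩
    obtain ⟨hcS, hcV⟩ := hdis c c' hsym
    -- The last edge of a tail touches `S`, whereas symmetric pairs have no vertex in `S`.
    have hct : c ≠ t (κ _ hcS) := by
      intro h
      have := hnear (κ _ hcS)
      rw [← h] at this
      exact hcV _ (incident_of_side this) (hv _)
    obtain ⟨a, w, haK, heven, h1, h2, h3⟩ :=
      (hK (κ _ hcS)).exists_even_edge ((hmem hcS _).2 rfl) hsym hct
    have ha := heS heven
    have hκa := (hmem ha _).1 haK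
    have hi : C.IsInner a := by
      have hn : C.side (!δ (κ _ hcS)) a ≠ none := by
        rcases h3 with h3 | h3
        · rw [h3, hnear]; simp
        · exact h3
      have hn' : C.side (δ (κ _ hcS)) a ≠ none := by rw [h1]; simp
      cases hδ : δ (κ _ hcS) <;> rw [hδ] at hn hn'
      · exact ⟨hn', hn⟩
      · exact ⟨hn, hn'⟩
    refine ⟨⟨a, hi, heven⟩, ?_⟩
    obtain ⟨ha', w', hw', hp'⟩ := hF ⟨a, hi, heven⟩
    replace hw' : C.side (δ (κ _ ha')) a = some w' := hw'
    replace hp' : ∀ x ∈ (F ⟨a, hi, heven⟩ : Sym2 C.E), C.side (!δ (κ _ ha')) x = some w' := hp'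
    rw [hκa] at hw' hp'
    obtain rfl : w = w' := Option.some_injective _ (h1.symm.trans hw')
    have h2' := (hsym.side_eq (!δ (κ _ hcS))).symm.trans h2
    have hcases : ∀ x ∈ (F ⟨a, hi, heven⟩ : Sym2 C.E), x = c ∨ x = c' := by
      intro x hx
      rcases eq_of_incident (incident_of_side h1) (incident_of_side h2) (incident_of_side h2')
        (ne_of_side h1 h2) (ne_of_side h1 h2') hsym.1 (incident_of_side (hp' x hx)) with h | h | h
      · exact absurd h.symm (ne_of_side h1 (hp' x hx))
      · exact Or.inl h
      · exact Or.inr h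
    apply Subtype.ext
    obtain ⟨x, y, hxy, hsym'⟩ := (F ⟨a, hi, heven⟩).2
    have hx := hcases x (by rw [hxy]; simp)
    have hy := hcases y (by rw [hxy]; simp)
    rw [hxy]
    rcases hx with rfl | rfl <;> rcases hy with rfl | rfl
    · exact absurd rfl hsym'.1
    · rfl
    · exact Sym2.eq_swap
    · exact absurd rfl hsym'.1

/-- For `I = ∅` the product over cycles is empty and the two powers of `2` cancel, so the
multiplicity is `1`. -/
theorem IsZigzagFor.hasOddMult {S : Set (C.V ⊕ C.E)} (hS : C.IsZigzagFor S) : C.HasOddMult := by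
  refine ⟨⟨∅, Set.empty_subset _, fun _ => true, fun _ _ _ _ _ => rfl⟩, 1, odd_one, ?_⟩
  unfold Colouring.mult
  simp [hS.card_even_inner_edges]

/-! ### The odd subgraph reaches both sides -/

/-- If all ends on one side are odd and their number is odd, then one of them belongs to the odd
subgraph. -/
theorem IsZigzagFor.exists_end {S : Set (C.V ⊕ C.E)} (hS : C.IsZigzagFor S) {σ : Bool}
    (hodd : ∀ e, C.side σ e = none → Odd (C.weight e))
    (hcard : ∀ [DecidablePred fun e => C.side σ e = none],
      Odd (Finset.univ.filter fun e => C.side σ e = none).card) :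
    ∃ e, Sum.inr e ∈ S ∧ C.side σ e = none := by
  classical
  by_contra! hno
  obtain ⟨v₀, -⟩ := hS.exists_vertex
  have hex : ∀ a, C.side σ a = none → ∃ b, C.IsSymPair a b := by
    intro a ha
    obtain ⟨K, haK, -, hK, -⟩ := tails_iff.1 hS.tails _ fun h => hno a h ha
    obtain ⟨τ, k, e, v, -, hb, -⟩ := isTail_iff.1 hK
    exact hb.exists_isSymPair_of_end haK (hodd a ha) ha
  -- Three ends at one trivalent vertex in the same direction would violate balancing.
  have huniq : ∀ a b b', C.side σ a = none → C.IsSymPair a b → C.IsSymPair a b' → b = b' := by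
    intro a b b' ha hab hab'
    by_contra hbb
    obtain ⟨w, hw⟩ := Option.ne_none_iff_exists'.1 (side_not_ne_none v₀ ha)
    have hbal := C.balanced w
    have hbal' : (∑ e with C.side (!σ) e = some w, C.weight e) =
        ∑ e with C.side σ e = some w, C.weight e := by
      cases σ
      · exact hbal
      · exact hbal.symm
    have hpos : 0 < ∑ e with C.side (!σ) e = some w, C.weight e :=
      Finset.sum_pos (fun e _ => C.weight_pos e) ⟨a, by simpa using hw⟩
    rw [hbal'] at hpos
    obtain ⟨e, he⟩ : (Finset.univ.filter fun e => C.side σ e = some w).Nonempty := by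
      rw [Finset.nonempty_iff_ne_empty]
      intro h0
      rw [h0] at hpos
      simp at hpos
    have he' : C.side σ e = some w := by simpa using he
    rcases eq_of_incident (incident_of_side hw)
      (incident_of_side ((hab.side_eq (!σ)).symm.trans hw))
      (incident_of_side ((hab'.side_eq (!σ)).symm.trans hw)) hab.1 hab'.1 hbb
      (incident_of_side he') with rfl | rfl | rfl
    · cases ha.symm.trans he'
    · cases ((hab.side_eq σ).symm.trans ha).symm.trans he'
    · cases ((hab'.side_eq σ).symm.trans ha).symm.trans he'
  choose! g hg using hex
  have hmem : ∀ a, C.side σ a = none → C.side σ (g a) = none := fun a ha =>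
    ((hg a ha).side_eq σ).symm.trans ha
  -- Exchanging the two ends of each fork is an involution without fixed points, so the number of
  -- ends would be even.
  have hsum : ∑ a ∈ Finset.univ.filter (fun e => C.side σ e = none), (1 : ZMod 2) = 0 := by
    refine Finset.sum_involution (fun a _ => g a) (fun _ _ => by decide) ?_ ?_ ?_
    · intro a ha _
      exact (hg a (by simpa using ha)).1.symm
    · intro a ha
      simpa using hmem a (by simpa using ha)
    · intro a ha
      have ha' : C.side σ a = none := by simpa using ha
      exact huniq (g a) _ _ (hmem a ha') (hg _ (hmem a ha')) (hg a ha').symm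
  rw [Finset.sum_const, nsmul_one, ZMod.natCast_eq_zero_iff_even] at hsum
  exact Nat.not_even_iff_odd.2 hcard hsum

theorem IsOfType.good {g d : ℕ} {z : Finset ℝ} (hd : Odd d)
    (h : C.IsOfType g (Multiset.replicate d 1) (Multiset.replicate d 1) z)
    (hC : C.IsGeneralizedZigzag) :
    Good g (Multiset.replicate d 1) (Multiset.replicate d 1) [(true, 1), (false, 1)] [] z C := by
  obtain ⟨S, hS⟩ := hC
  refine ⟨h, S, hS, ?_, by simp⟩
  have key : ∀ σ, C.EndIn S (σ, 1) := by
    intro σ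
    have hends : ∀ [DecidablePred fun e => C.side σ e = none],
        (Finset.univ.filter fun e => C.side σ e = none).val.map C.weight =
          Multiset.replicate d 1 := by
      intro _
      cases σ
      · convert h.left_ends
        rfl
      · convert h.right_ends
        rfl
    have hone : ∀ e, C.side σ e = none → C.weight e = 1 := by
      classical
      intro e he
      refine Multiset.eq_of_mem_replicate (n := d) ?_
      rw [← hends]
      exact Multiset.mem_map_of_mem _ (by simpa using he)
    obtain ⟨e, heS, he⟩ := hS.exists_end (σ := σ) (fun e he => by rw [hone e he]; exact odd_one)
      (by
        intro _
        have := congrArg Multiset.card hends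
        rw [Multiset.card_map, Multiset.card_replicate] at this
        rw [Finset.card_def, this]
        exact hd)
    exact ⟨e, heS, he, hone e he⟩
  intro p hp
  rcases List.mem_cons.1 hp with rfl | hp
  · exact key true
  · rw [List.mem_singleton.1 hp]
    exact key false

/-! ### From injections to zigzag numbers -/

/-- One representative is chosen in each class, so the map on covers need not respect isomorphism.
Each summand on the left is `1`, and every summand on the right is at least `1`. -/
theorem zigzagNumber_le {g g' : ℕ} {L M L' M' : Multiset ℕ} {z z' : Finset ℝ}
    (h : Dominated (fun C => C.IsOfType g L M z ∧ C.IsGeneralizedZigzag)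
      (fun C => C.IsOfType g' L' M' z' ∧ C.IsGeneralizedZigzag)) :
    zigzagNumber g L M z ≤ zigzagNumber g' L' M' z' := by
  obtain ⟨f, hf, hf'⟩ := h
  choose r hr hrP using fun c : zigzagClasses g L M z => c.2
  let ι : zigzagClasses g L M z → zigzagClasses g' L' M' z' :=
    fun c => ⟨⟦f (r c)⟧, f (r c), rfl, hf _ (hrP c)⟩
  have hι : Function.Injective ι := by
    intro c d hcd
    have h1 : Nonempty (Iso (f (r c)) (f (r d))) := Quotient.exact (congrArg Subtype.val hcd)
    have h2 : (⟦r c⟧ : Quotient isoSetoid) = ⟦r d⟧ :=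
      Quotient.sound (hf' _ _ (hrP c) (hrP d) h1)
    exact Subtype.ext ((hr c).symm.trans (h2.trans (hr d)))
  unfold zigzagNumber
  calc ∑' c : zigzagClasses g L M z, (2 : ℝ≥0∞) ^ zigzagExponent c
      ≤ ∑' c : zigzagClasses g L M z, (2 : ℝ≥0∞) ^ zigzagExponent (ι c) := by
        refine ENNReal.tsum_le_tsum fun c => ?_
        have hc : zigzagExponent (c : Quotient isoSetoid) = 0 := by
          obtain ⟨S, hS⟩ := (hrP c).2
          exact if_pos ⟨r c, hr c, hS.hasOddMult⟩
        rw [hc, pow_zero]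
        exact one_le_pow₀ one_le_two
    _ ≤ _ := ENNReal.tsum_comp_le_tsum_of_injective hι fun c => 2 ^ zigzagExponent c

/-! ### Splitting a partition into odd parts and tails -/

/-- An even part is removed as a leaf; an odd part has a twin by evenness of its multiplicity, and
the two are removed as a fork. -/
theorem isTailWeights_of_even_count (n : ℕ) : ∀ T : Multiset ℕ, T.card = n → 0 ∉ T →
    (∀ a, Odd a → Even (T.count a)) → IsTailWeights T := by
  induction n using Nat.strong_induction_on with
  | _ n ih =>
    intro T hn h0 hT
    rcases T.empty_or_exists_mem with rfl | ⟨a, ha⟩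
    · exact .zero
    obtain ⟨T, rfl⟩ := Multiset.exists_cons_of_mem ha
    have ha0 : 0 < a := Nat.pos_of_ne_zero fun h => h0 (h ▸ ha)
    rcases Nat.even_or_odd' a with ⟨k, rfl | hk⟩
    · refine .leaf k T (by omega) (ih T.card (by simp [← hn]) T rfl
        (fun h => h0 (Multiset.mem_cons_of_mem h)) fun b hb => ?_)
      have := hT b hb
      rwa [Multiset.count_cons_of_ne] at this
      rintro rfl
      exact Nat.not_even_iff_odd.2 hb (even_two_mul k)
    · have hodd : Odd a := ⟨k, hk⟩
      have hcount := hT a hodd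
      rw [Multiset.count_cons_self, Nat.even_add_one, Nat.not_even_iff_odd] at hcount
      obtain ⟨T, rfl⟩ := Multiset.exists_cons_of_mem (Multiset.count_pos.1 hcount.pos)
      refine .fork a T ha0 (ih T.card (by simp [← hn]) T rfl
        (fun h => h0 (Multiset.mem_cons_of_mem (Multiset.mem_cons_of_mem h))) fun b hb => ?_)
      have := hT b hb
      rw [Multiset.count_cons, Multiset.count_cons] at this
      split_ifs at this
      · rwa [add_assoc, Nat.even_add, iff_true_right (show Even (1 + 1) from even_two)] at this
      · exact this

theorem exists_isTailWeights (X : Multiset ℕ) (h0 : 0 ∉ X) :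
    ∃ T, IsTailWeights T ∧ X = (oddTail X).val + T := by
  have hle : (oddTail X).val ≤ X := by
    rw [Finset.val_le_iff_val_subset]
    intro a ha
    exact Multiset.mem_toFinset.1 (Finset.mem_filter.1 ha).1
  refine ⟨X - (oddTail X).val, isTailWeights_of_even_count _ _ rfl
    (fun h => h0 (Multiset.mem_of_le (Multiset.sub_le_self _ _) h)) fun a ha => ?_,
    (add_tsub_cancel_of_le hle).symm⟩
  rw [Multiset.count_sub]
  by_cases hc : Odd (X.count a)
  · have hmem : a ∈ oddTail X := by
      unfold oddTail
      exact Finset.mem_filter.2 ⟨Multiset.mem_toFinset.2 (Multiset.count_pos.1 hc.pos), ha, hc⟩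
    rw [Multiset.count_eq_one_of_mem (oddTail X).nodup hmem]
    exact Nat.Odd.sub_odd hc odd_one
  · have hmem : a ∉ (oddTail X).val := fun h => hc (Finset.mem_filter.1 h).2.2
    rw [Multiset.count_eq_zero_of_notMem hmem]
    exact Nat.not_odd_iff_even.1 hc

theorem IsTailWeights.add {T U : Multiset ℕ} (hT : IsTailWeights T) (hU : IsTailWeights U) :
    IsTailWeights (T + U) := by
  induction hT with
  | zero => rwa [zero_add]
  | leaf k T hk _ ih => rw [Multiset.cons_add]; exact .leaf k _ hk ih
  | fork k T hk _ ih => rw [Multiset.cons_add, Multiset.cons_add]; exact .fork k _ hk ih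

theorem isTailWeights_ones (n : ℕ) : IsTailWeights (Multiset.replicate (2 * n) 1) := by
  induction n with
  | zero => exact .zero
  | succ n ih => exact .fork 1 _ one_pos ih

theorem IsTailWeights.even_sum {T : Multiset ℕ} (hT : IsTailWeights T) : Even T.sum := by
  induction hT with
  | zero => simp
  | leaf k T _ _ ih => rw [Multiset.sum_cons]; exact (even_two_mul k).add ih
  | fork k T _ _ ih =>
    rw [Multiset.sum_cons, Multiset.sum_cons, ← add_assoc]
    exact (Even.add_self k).add ih

theorem dominated_join_left (g : ℕ) {T : Multiset ℕ} (hT : IsTailWeights T)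
    {ins : List (Bool × ℕ)} (hins : ∀ p ∈ ins, p.1 = true) (L M : Multiset ℕ) (b r : ℕ) :
    Dominated (Good g (b ::ₘ L) M ((false, b) :: ins) [] (firstPoints r))
      (Good g ((b + T.sum) ::ₘ L) (T + M) ((false, b + T.sum) :: ins) []
        (firstPoints (r + T.card))) := by
  have := ((dominated_reflect g (b ::ₘ L) M ((false, b) :: ins) [] rfl).trans
    (dominated_join g hT (ins := ins.map flip) (by simpa [flip] using hins) M L b r)).trans
      (dominated_reflect g _ _ _ _ rfl)
  simpa [flip_flip, flip] using this

/-! ### Construction of the required ends -/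

/-- The covers with simple ends, whose odd subgraph has an end on both sides. -/
def Simple (g n : ℕ) : TropicalCover → Prop :=
  Good g (Multiset.replicate (2 * n + 1) 1) (Multiset.replicate (2 * n + 1) 1)
    [(true, 1), (false, 1)] [] (firstPoints (4 * n + 2 * g))

/-- The left end of `S` grows from `1` to `2 * j + 1` by absorbing `j` forks of weight `1` coming
from the right. -/
theorem dominated_left_end (g n j : ℕ) :
    Dominated (Simple g n)
      (Good g ((2 * j + 1) ::ₘ Multiset.replicate (2 * n) 1)
        (1 ::ₘ Multiset.replicate (2 * j + 2 * n) 1)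
        [(true, 1), (false, 2 * j + 1)] [] (firstPoints (4 * n + 2 * g + 2 * j))) := by
  have h1 : Dominated (Simple g n)
      (Good g (1 ::ₘ Multiset.replicate (2 * n) 1) (Multiset.replicate (2 * n + 1) 1)
        [(false, 1), (true, 1)] [] (firstPoints (4 * n + 2 * g))) :=
    dominated_mono (by intro p hp; simp at hp ⊢; tauto) (List.nil_subset _)
  have h2 := h1.trans (dominated_join_left g (isTailWeights_ones j) (by simp) _ _ _ _)
  rw [Multiset.sum_replicate, Multiset.card_replicate, ← Multiset.replicate_add, smul_eq_mul,
    mul_one, add_comm 1, ← add_assoc, Multiset.replicate_succ] at h2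
  exact h2.trans (dominated_mono (by intro p hp; simp at hp ⊢; tauto) (List.nil_subset _))

/-- One odd part on each side. The left end of `S` is raised to `2 * j + 1`; the right end absorbs
`T` and `j` forks of weight `1`, then sheds `U` and is left with weight `b`. Thus `2 * j` ones are
added on both sides. -/
theorem dominated_opposite_ends {T U : Multiset ℕ} (hT : IsTailWeights T) (hU : IsTailWeights U)
    {j b : ℕ} (hb : 0 < b) (hsum : 2 * j + 1 + T.sum = b + U.sum) (g n : ℕ) :
    Dominated (Simple g n)
      (Good g (addOnes ((2 * j + 1) ::ₘ T) (2 * (n + j))) (addOnes (b ::ₘ U) (2 * (n + j))) [] []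
        (firstPoints (T.card + U.card + 2 * g + 4 * (n + j)))) := by
  have h1 := (dominated_left_end g n j).trans
    (dominated_join g (hT.add (isTailWeights_ones j)) (by simp) _ _ _ _)
  have hs : 1 + (T + Multiset.replicate (2 * j) 1).sum = b + U.sum := by
    rw [← hsum]; simp; ring
  rw [hs] at h1
  have h2 := (h1.trans (dominated_split g hU (by simp) _ _ _ _ hb)).trans
    (dominated_mono (List.nil_subset _) (List.nil_subset _))
  convert h2 using 2
  · rw [addOnes, Multiset.add_cons, Multiset.cons_add, add_assoc, ← Multiset.replicate_add]
    congr 3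
    ring
  · rw [addOnes, Multiset.cons_add]
    congr 3
    ring
  · congr 1
    simp
    ring

/-- Both odd parts on the left. After the left end is raised to `2 * i + 1`, the right end absorbs
`T` and `i + j + 1` forks of weight `1` and sheds `U`, returning to weight `1`. It then meets a left
end of weight `1`, the even edge of weight `2` going off to the right splits into a fork, and `S`
turns back to the left, where its new end grows to `2 * j + 1`. -/
theorem dominated_left_ends {T U : Multiset ℕ} (hT : IsTailWeights T) (hU : IsTailWeights U)
    {i j : ℕ} (hsum : 2 * i + 1 + (2 * j + 1) + T.sum = U.sum) (g n : ℕ) :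
    Dominated (Simple g n)
      (Good g (addOnes ((2 * i + 1) ::ₘ (2 * j + 1) ::ₘ T) (2 * (n + (i + j + 1))))
        (addOnes U (2 * (n + (i + j + 1)))) [] []
        (firstPoints (T.card + U.card + 2 * g + 4 * (n + (i + j + 1))))) := by
  have h1 := (dominated_left_end g n i).trans
    (dominated_join g (hT.add (isTailWeights_ones (i + j + 1))) (by simp) _ _ _ _)
  have hs : 1 + (T + Multiset.replicate (2 * (i + j + 1)) 1).sum = 1 + U.sum := by
    rw [← hsum]; simp; ring
  rw [hs] at h1
  have h2 := (((h1.trans (dominated_split g hU (by simp) _ _ _ _ one_pos)).trans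
    (dominated_turnEnd g _ _ one_pos (k := 1) rfl (by simp) _)).trans
    (dominated_fork g _ _ one_pos _ _)).trans (dominated_mono
      (ins' := [(false, 1)]) (by simp) (List.nil_subset _))
  have h3 := (h2.trans (dominated_join_left g (isTailWeights_ones j) (by simp) _ _ _ _)).trans
    (dominated_mono (List.nil_subset _) (List.nil_subset _))
  convert h3 using 2
  · rw [addOnes, Multiset.add_cons, Multiset.cons_add, Multiset.cons_add, add_assoc T,
      ← Multiset.replicate_add, Multiset.cons_swap, Multiset.sum_replicate, smul_eq_mul, mul_one,
      add_comm 1]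
    congr 4
    ring
  · rw [addOnes, ← Multiset.add_cons, ← Multiset.add_cons, ← Multiset.replicate_succ,
      ← Multiset.replicate_succ, add_left_comm (Multiset.replicate _ _) U,
      ← Multiset.replicate_add]
    congr 2
    ring
  · congr 1
    simp
    ring

/-- The inequality between zigzag numbers for partitions with a given number of added ones. -/
theorem zigzagNumber_simple_le {X Y : Multiset ℕ} {N : ℕ} {g n : ℕ}
    (h : Dominated (Simple g n) (Good g (addOnes X (2 * (n + N))) (addOnes Y (2 * (n + N))) [] []
      (firstPoints (X.card + Y.card + 2 * g + 4 * (n + N) - 2))))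
    {z₀ z₁ : Finset ℝ} (h₀ : z₀.card = X.card + Y.card + 2 * g + 4 * (n + N) - 2)
    (h₁ : z₁.card = 4 * n + 2 * g) :
    zigzagNumber g (addOnes 0 (2 * n + 1)) (addOnes 0 (2 * n + 1)) z₁ ≤
      zigzagNumber g (addOnes X (2 * (n + N))) (addOnes Y (2 * (n + N))) z₀ := by
  apply zigzagNumber_le
  have hstart : Dominated (fun C => C.IsOfType g (addOnes 0 (2 * n + 1)) (addOnes 0 (2 * n + 1)) z₁ ∧
      C.IsGeneralizedZigzag) (Simple g n) := by
    refine Dominated.trans (Dominated.of_imp fun C hC => ?_)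
      (dominated_reposition g _ _ _ _ (z := z₁) (h₁.trans (card_firstPoints _).symm))
    have := hC.1
    rw [addOnes, zero_add] at this
    exact this.good (odd_two_mul_add_one n) hC.2
  refine (hstart.trans h).trans ((dominated_reposition g _ _ _ _ (z' := z₀)
    ((card_firstPoints _).trans h₀.symm)).trans (Dominated.of_imp ?_))
  rintro C ⟨ht, S, hS, -⟩
  exact ⟨ht, S, hS⟩

theorem exists_dominated_of_card_eq_two {X Y T U : Multiset ℕ} {d : ℕ} (hT : IsTailWeights T)
    (hU : IsTailWeights U) (h1 : (oddTail X).card = 2) (h2 : (oddTail Y).card = 0)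
    (hX : X = (oddTail X).val + T) (hY : Y = (oddTail Y).val + U)
    (hsumT : (oddTail X).val.sum + T.sum = d) (hsumU : (oddTail Y).val.sum + U.sum = d) :
    ∃ N : ℕ, ∀ g n : ℕ, Dominated (Simple g n)
      (Good g (addOnes X (2 * (n + N))) (addOnes Y (2 * (n + N))) [] []
        (firstPoints (X.card + Y.card + 2 * g + 4 * (n + N) - 2))) := by
  classical
  have hodd : ∀ {a}, a ∈ oddTail X → Odd a := fun h => (Finset.mem_filter.1 h).2.1
  obtain ⟨a, b, hab, hab'⟩ := Finset.card_eq_two.1 h1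
  obtain ⟨i, rfl⟩ := hodd (a := a) (by rw [hab']; simp)
  obtain ⟨j, rfl⟩ := hodd (a := b) (by rw [hab']; simp)
  rw [Finset.card_eq_zero.1 h2, Finset.empty_val, zero_add] at hY
  rw [Finset.card_eq_zero.1 h2, Finset.empty_val, Multiset.sum_zero, zero_add] at hsumU
  rw [hab', Finset.insert_val_of_notMem (by simpa using hab), Finset.singleton_val,
    Multiset.cons_add, Multiset.singleton_add] at hX
  rw [hab', Finset.insert_val_of_notMem (by simpa using hab), Finset.singleton_val,
    Multiset.sum_cons, Multiset.sum_singleton] at hsumT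
  refine ⟨i + j + 1, fun g n => ?_⟩
  rw [hX, hY]
  convert dominated_left_ends hT hU (hsumT.trans hsumU.symm) g n using 3
  simp only [Multiset.card_cons]
  omega

theorem exists_dominated_simple {d : ℕ} (lam mu : Nat.Partition d)
    (h : (oddTail lam.parts).card + (oddTail mu.parts).card ≤ 2) :
    ∃ N : ℕ, ∀ g n : ℕ, Dominated (Simple g n)
      (Good g (addOnes lam.parts (2 * (n + N))) (addOnes mu.parts (2 * (n + N))) [] []
        (firstPoints (lam.parts.card + mu.parts.card + 2 * g + 4 * (n + N) - 2))) := by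
  have hzero : ∀ p : Nat.Partition d, 0 ∉ p.parts := fun p h0 => lt_irrefl _ (p.parts_pos h0)
  obtain ⟨T, hT, hlam⟩ := exists_isTailWeights lam.parts (hzero lam)
  obtain ⟨U, hU, hmu⟩ := exists_isTailWeights mu.parts (hzero mu)
  have hodd : ∀ {X : Multiset ℕ} {a}, a ∈ oddTail X → Odd a := fun h => (Finset.mem_filter.1 h).2.1
  -- A sum of odd numbers has the parity of the number of summands, and tails have even total
  -- weight; hence both cardinalities have the parity of `d`.
  have hparity : ∀ X : Multiset ℕ, Even (oddTail X).val.sum ↔ Even (oddTail X).card := by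
    intro X
    have hsum : (oddTail X).val.sum = ∑ a ∈ oddTail X, a := by
      rw [Finset.sum_eq_multiset_sum, Multiset.map_id']
    rw [hsum, Finset.even_sum_iff_even_card_odd, Finset.filter_true_of_mem fun a ha => hodd ha]
  have hsumT : (oddTail lam.parts).val.sum + T.sum = d := by
    rw [← Multiset.sum_add, ← hlam, lam.parts_sum]
  have hsumU : (oddTail mu.parts).val.sum + U.sum = d := by
    rw [← Multiset.sum_add, ← hmu, mu.parts_sum]
  have hpT := congrArg Even hsumT
  have hpU := congrArg Even hsumU
  rw [Nat.even_add, iff_true_right hT.even_sum, hparity] at hpT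
  rw [Nat.even_add, iff_true_right hU.even_sum, hparity] at hpU
  have hpar : Even (oddTail lam.parts).card ↔ Even (oddTail mu.parts).card := by rw [hpT, hpU]
  have hcases : (oddTail lam.parts).card = 0 ∧ (oddTail mu.parts).card = 0 ∨
      (oddTail lam.parts).card = 1 ∧ (oddTail mu.parts).card = 1 ∨
      (oddTail lam.parts).card = 2 ∧ (oddTail mu.parts).card = 0 ∨
      (oddTail lam.parts).card = 0 ∧ (oddTail mu.parts).card = 2 := by
    rw [Nat.even_iff, Nat.even_iff] at hpar
    omega
  rcases hcases with ⟨h1, h2⟩ | ⟨h1, h2⟩ | ⟨h1, h2⟩ | ⟨h1, h2⟩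
  · rw [Finset.card_eq_zero.1 h1, Finset.empty_val, zero_add] at hlam
    rw [Finset.card_eq_zero.1 h2, Finset.empty_val, zero_add] at hmu
    rw [Finset.card_eq_zero.1 h1, Finset.empty_val, Multiset.sum_zero, zero_add] at hsumT
    rw [Finset.card_eq_zero.1 h2, Finset.empty_val, Multiset.sum_zero, zero_add] at hsumU
    -- Without odd parts, two of the added ones on the left serve as the ends of `S`, balanced by an
    -- additional fork of weight `1` on the right. The construction itself needs `1`, and the two
    -- ones moved into each partition raise this to `2`.
    refine ⟨2, fun g n => ?_⟩
    have := dominated_left_ends hT (.fork 1 U one_pos hU) (i := 0) (j := 0)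
      (by simp only [Multiset.sum_cons]; omega) g n
    rw [hlam, hmu]
    convert this using 2
    · rw [addOnes, addOnes, Multiset.cons_add, Multiset.cons_add, ← Multiset.add_cons,
        ← Multiset.add_cons, ← Multiset.replicate_succ, ← Multiset.replicate_succ]
      rfl
    · rw [addOnes, addOnes, Multiset.cons_add, Multiset.cons_add, ← Multiset.add_cons,
        ← Multiset.add_cons, ← Multiset.replicate_succ, ← Multiset.replicate_succ]
      rfl
    · congr 1
      simp only [Multiset.card_cons]
      omega
  · obtain ⟨a, ha⟩ := Finset.card_eq_one.1 h1
    obtain ⟨b, hb⟩ := Finset.card_eq_one.1 h2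
    obtain ⟨j, rfl⟩ := hodd (ha ▸ Finset.mem_singleton_self a : a ∈ oddTail lam.parts)
    have hb0 := (hodd (hb ▸ Finset.mem_singleton_self b : b ∈ oddTail mu.parts)).pos
    rw [ha, Finset.singleton_val] at hlam hsumT
    rw [hb, Finset.singleton_val] at hmu hsumU
    rw [Multiset.singleton_add] at hlam hmu
    rw [Multiset.sum_singleton] at hsumT hsumU
    refine ⟨j, fun g n => ?_⟩
    rw [hlam, hmu]
    convert dominated_opposite_ends hT hU hb0 (hsumT.trans hsumU.symm) g n using 3
    simp only [Multiset.card_cons]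
    omega
  · exact exists_dominated_of_card_eq_two hT hU h1 h2 hlam hmu hsumT hsumU
  · obtain ⟨N, hN⟩ := exists_dominated_of_card_eq_two hU hT h2 h1 hmu hlam hsumU hsumT
    refine ⟨N, fun g n => ?_⟩
    rw [add_comm lam.parts.card]
    -- Two odd parts on the right reduce by reflection to two on the left.
    exact ((hN g n).trans (dominated_reflect g _ _ _ _ rfl))

end TropicalCover

theorem theorem6p2 {d : ℕ} (lam mu : Nat.Partition d)
    (h : (oddTail lam.parts).card + (oddTail mu.parts).card ≤ 2) :
    ∃ N₀ : ℕ, ∀ g m : ℕ, N₀ < m → ∀ z₀ z₁ : Finset ℝ,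
      z₀.card = lam.parts.card + mu.parts.card + 2 * g + 4 * m - 2 →
      z₁.card = 4 * m - 4 * N₀ + 2 * g →
      zigzagNumber g (addOnes lam.parts (2 * m)) (addOnes mu.parts (2 * m)) z₀ ≥
        zigzagNumber g (addOnes 0 (2 * m - 2 * N₀ + 1)) (addOnes 0 (2 * m - 2 * N₀ + 1)) z₁ := by
  obtain ⟨N, hN⟩ := TropicalCover.exists_dominated_simple lam mu h
  refine ⟨N, fun g m hm z₀ z₁ h₀ h₁ => ?_⟩
  -- With `m = n + N` the initial covers have `2 * n + 1` ends on each side, and the truncated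
  -- subtractions are exact.
  obtain ⟨n, rfl⟩ := Nat.exists_eq_add_of_le' hm.le
  rw [show 2 * (n + N) - 2 * N + 1 = 2 * n + 1 by omega]
  exact TropicalCover.zigzagNumber_simple_le (hN g n) h₀ (by omega)
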